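/- Consider the position-based click model with $K$ arms and $L$ positions, $1\le L\le K$, arm expectations $1>\theta_1>\dots>\theta_K>0$ and examination probabilities $1\ge\kappa_1>\dots>\kappa_L>0$. In each round $t=1,2,\dots$ the learner shows an ordered list $A(t)=(A_1(t),\dots,A_L(t))$ of $L$ distinct arms, chosen from its past observations and possibly private randomization. Given the past, $X_l(t)\sim\mathcal B(\theta_{A_l(t)})$ and $Y_l(t)\sim\mathcal B(\kappa_l)$, $1\le l\le L$, are independent; the learner observes only the products $Z_l(t)=X_l(t)Y_l(t)$ and receives the reward $r_{A(t)}=\sum_{l=1}^L Z_l(t)$. For a list $a$ let $\mu_a=\sum_{l=1}^L\kappa_l\theta_{a_l}$; the optimal list is $a^*=(1,\dots,L)$. Let $\Delta_a=\mu_{a^*}-\mu_a$ and $\mathbb E[R(T)]=\mathbb E\big[\sum_{t=1}^T(\mu_{a^*}-r_{A(t)})\big]$. Put $S_k(t)=\sum_{s=1}^{t-1}\sum_{l=1}^L Z_l(s)\mathbf 1\{A_l(s)=k\}$, $N_k(t)=\sum_{s=1}^{t-1}\sum_{l=1}^L\mathbf 1\{A_l(s)=k\}$ and $\tilde N_k(t)=\sum_{s=1}^{t-1}\sum_{l=1}^L\kappa_l\mathbf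 1\{A_l(s)=k\}$. PBM-UCB with parameter $\delta$ shows in each round $t\ge1$ the $L$ arms with the largest indices $$U_k(t,\delta)=\frac{S_k(t)}{\tilde N_k(t)}+\sqrt{\frac{N_k(t)}{\tilde N_k(t)}}\sqrt{\frac{\delta}{2\tilde N_k(t)}}\qquad(U_k(t,\delta)=+\infty\text{ if }N_k(t)=0),$$ in decreasing order of the index, with ties broken arbitrarily. Let $$C(\kappa)=\min_{1\le l\le L}\frac{\big(\sum_{j=1}^L\kappa_j\big)^2/l+\big(\sum_{j=1}^l\kappa_j\big)^2}{\kappa_L^2},\qquad \Delta=\min_{a\in\sigma(a^*)\setminus\{a^*\}}\Delta_a,$$ where $\sigma(a^*)$ is the set of permutations of $a^*$ (for $L=1$ the minimum is over the empty set and $L/\Delta$ is read as $0$). Theorem. For all $\epsilon>0$ and $L\ge1$ there is a constant $C_0=C_0(\epsilon,L)$, which depends only on $\epsilon$ and on the number $L$ of positions (not on $K$, $\theta$, $\kappa$ or $T$), such that for all $K\ge L$, all $\theta$ and $\kappa$ as above and all $T\ge1$, PBM-UCB run with $\delta=(1+\epsilon)\log t$ in round $t$ satisfies $$\mathbb E[R(T)]\le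 C_0(\epsilon,L)+16(1+\epsilon)\,C(\kappa)\log T\left(\frac{L}{\Delta}+\sum_{k=L+1}^{K}\frac{1}{\kappa_L(\theta_L-\theta_k)}\right).$$ -/

import Mathlib

open MeasureTheory

noncomputable section

namespace PBM

/-- An action: an ordered list of `L` distinct arms among `K`.
Arm `k` of the usual numbering `1, …, K` is the element `k - 1` of `Fin K`,
and position `l` is the element `l - 1` of `Fin L`. -/
abbrev Action (K L : ℕ) : Type := Fin L ↪ Fin K

/-- The optimal list `a* = (1, …, L)` (arms and positions are sorted in decreasing order). -/
def optimalAction {K L : ℕ} (hLK : L ≤ K) : Action K L := Fin.castLEEmb hLK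

/-- The last position `L`. -/
def lastPos {L : ℕ} (hL : 0 < L) : Fin L := ⟨L - 1, Nat.sub_lt hL Nat.one_pos⟩

/-- The expected reward `μ_a = ∑_l κ_l θ_{a_l}` of the action `a`. -/
def meanReward {K L : ℕ} (κ : Fin L → ℝ) (θ : Fin K → ℝ) (a : Action K L) : ℝ :=
  ∑ l, κ l * θ (a l)

/-- The gap `Δ_a = μ* - μ_a`. -/
def gap {K L : ℕ} (hLK : L ≤ K) (κ : Fin L → ℝ) (θ : Fin K → ℝ) (a : Action K L) : ℝ :=
  meanReward κ θ (optimalAction hLK) - meanReward κ θ a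

/-- `Δ`: the minimal gap among the permutations of the optimal action other than itself.
It is used for `2 ≤ L` only, when there is such a permutation. -/
def minPermGap {K L : ℕ} (hLK : L ≤ K) (κ : Fin L → ℝ) (θ : Fin K → ℝ) : ℝ :=
  ⨅ σ : {σ : Equiv.Perm (Fin L) // σ ≠ 1},
    gap hLK κ θ (σ.1.toEmbedding.trans (optimalAction hLK))

/-- The term `L / Δ`. For `L = 1` the optimal action has no other permutation, so that
`Δ` is the minimum of the empty set, `+∞`, and the term is `0`. -/
def permTerm {K L : ℕ} (hLK : L ≤ K) (κ : Fin L → ℝ) (θ : Fin K → ℝ) : ℝ :=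
  if 2 ≤ L then (L : ℝ) / minPermGap hLK κ θ else 0

/-- `C(κ) = min_{1 ≤ l ≤ L} [(∑_{j ≤ L} κ_j)² / l + (∑_{j ≤ l} κ_j)²] / κ_L²`. -/
def kappaConst {L : ℕ} (hL : 0 < L) (κ : Fin L → ℝ) : ℝ :=
  ⨅ l : Fin L, ((∑ j, κ j) ^ 2 / ((l : ℕ) + 1 : ℝ) + (∑ j ∈ Finset.Iic l, κ j) ^ 2)
    / κ (lastPos hL) ^ 2

/-- The probability that a Bernoulli variable of parameter `p` takes the value `b`. -/
def bern (p : ℝ) (b : Bool) : ℝ := if b then p else 1 - p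

section Runs

variable {Ω : Type*} {K L : ℕ}

/-- The censored observation `Z_l(t) = X_l(t) Y_l(t)`, as a real number in `{0, 1}`. -/
def obs (X Y : ℕ → Ω → Fin L → Bool) (t : ℕ) (l : Fin L) (ω : Ω) : ℝ :=
  if X t ω l = true ∧ Y t ω l = true then 1 else 0

/-- A run of a learner in the position-based model with examination parameters `κ` and arm
expectations `θ`, with rounds `t = 1, 2, …` (the entries at time `0` play no role).
`ℱ t` is the information of the learner after round `t`: it contains the observations made so far
and possibly private randomization. The action `A (t + 1)` is chosen from `ℱ t`, and, given `ℱ t`,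
the variables `X_l(t + 1) ∼ B(θ_{A_l(t + 1)})` and `Y_l(t + 1) ∼ B(κ_l)`, `l = 1, …, L`,
are independent. The learner observes the products of `X_l` and `Y_l` only. -/
structure IsRun [mΩ : MeasurableSpace Ω] (μ : Measure Ω) (ℱ : Filtration ℕ mΩ)
    (κ : Fin L → ℝ) (θ : Fin K → ℝ) (A : ℕ → Ω → Action K L)
    (X Y : ℕ → Ω → Fin L → Bool) : Prop where
  measurable_X : ∀ t, Measurable (X t)
  measurable_Y : ∀ t, Measurable (Y t)
  action_predictable : ∀ (t : ℕ) (a : Action K L), MeasurableSet[ℱ t] {ω | A (t + 1) ω = a}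
  obs_adapted : ∀ (t : ℕ) (l : Fin L), Measurable[ℱ (t + 1)] (obs X Y (t + 1) l)
  feedback_law : ∀ (t : ℕ) (x y : Fin L → Bool),
    μ[Set.indicator {ω | X (t + 1) ω = x ∧ Y (t + 1) ω = y} (fun _ => (1 : ℝ)) | ℱ t]
      =ᵐ[μ] fun ω => ∏ l, bern (θ (A (t + 1) ω l)) (x l) * bern (κ l) (y l)

/-- `N_{k,l}(t)`: the number of rounds before `t` with arm `k` at position `l`. -/
def countPos (A : ℕ → Ω → Action K L) (k : Fin K) (l : Fin L) (t : ℕ) (ω : Ω) : ℝ :=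
  ∑ s ∈ Finset.Ico 1 t, if A s ω l = k then 1 else 0

/-- `N_k(t) = ∑_l N_{k,l}(t)`. -/
def count (A : ℕ → Ω → Action K L) (k : Fin K) (t : ℕ) (ω : Ω) : ℝ :=
  ∑ l, countPos A k l t ω

/-- `Ñ_k(t) = ∑_l κ_l N_{k,l}(t)`. -/
def wcount (κ : Fin L → ℝ) (A : ℕ → Ω → Action K L) (k : Fin K) (t : ℕ) (ω : Ω) : ℝ :=
  ∑ l, κ l * countPos A k l t ω

/-- `S_k(t) = ∑_l ∑_{s < t} Z_l(s) 1{A_l(s) = k}`. -/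
def clicks (A : ℕ → Ω → Action K L) (X Y : ℕ → Ω → Fin L → Bool) (k : Fin K) (t : ℕ)
    (ω : Ω) : ℝ :=
  ∑ l, ∑ s ∈ Finset.Ico 1 t, obs X Y s l ω * if A s ω l = k then 1 else 0

/-- The index `S_k(t) / Ñ_k(t) + √(N_k(t) / Ñ_k(t)) √(δ / (2 Ñ_k(t)))`, equal to `+∞` as long as
arm `k` has not been shown. -/
def ucb (κ : Fin L → ℝ) (A : ℕ → Ω → Action K L) (X Y : ℕ → Ω → Fin L → Bool)
    (δ : ℝ) (k : Fin K) (t : ℕ) (ω : Ω) : EReal :=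
  if count A k t ω = 0 then ⊤
  else ((clicks A X Y k t ω / wcount κ A k t ω
    + √(count A k t ω / wcount κ A k t ω) * √(δ / (2 * wcount κ A k t ω)) : ℝ) : EReal)

/-- `a` lists `L` arms with the largest indices `U`, in decreasing order of `U`
(ties may be broken in any way). -/
def IsTopList (U : Fin K → EReal) (a : Action K L) : Prop :=
  Antitone (fun l => U (a l)) ∧ ∀ k, k ∉ Set.range a → ∀ l, U k ≤ U (a l)

/-- The learner follows PBM-UCB with `δ = (1 + ε) log t`: in each round `t ≥ 1` it shows the `L`
arms of largest index, sorted by decreasing index. -/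
def FollowsPBMUCB (ε : ℝ) (κ : Fin L → ℝ) (A : ℕ → Ω → Action K L)
    (X Y : ℕ → Ω → Fin L → Bool) : Prop :=
  ∀ t : ℕ, 1 ≤ t → ∀ ω,
    IsTopList (fun k => ucb κ A X Y ((1 + ε) * Real.log t) k t ω) (A t ω)

/-- The expected regret `E[R(T)] = E[∑_{t ≤ T} (μ* - r_{A(t)})]`, where
`r_{A(t)} = ∑_l Z_l(t)` is the reward received in round `t`. -/
def expectedRegret [MeasurableSpace Ω] (μ : Measure Ω) (hLK : L ≤ K) (κ : Fin L → ℝ)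
    (θ : Fin K → ℝ) (X Y : ℕ → Ω → Fin L → Bool) (T : ℕ) : ℝ :=
  ∫ ω, ∑ t ∈ Finset.Icc 1 T, (meanReward κ θ (optimalAction hLK) - ∑ l, obs X Y t l ω) ∂μ

end Runs

end PBM

end

/-!
Why the bound holds. Let `N_k` count the displays of arm `k`, let `d_m = κ_m - κ_{m+1}` (with
`κ_{L+1} = 0`) and `D = 2 (1 + ε) log T / κ_L²`.

*One round.* Summation by parts writes the gap of a list as `∑ d_m g_m`, where `g_m` is the gap of
its first `m` arms as a set. Suppose that all indices `U_k` are at least `θ_k` and exceed it, for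
the shown arms, by at most `√(D / N_k)`. An arm `j ≤ m` missing from the first `m` shown ones then
has no larger index than any of these, so `θ_j ≤ U_k ≤ θ_k + √(D / N_k)` for every intruder `k > m`.
Hence `g_m` is at most the sum of `√(D / N_k)` over the intruders, each of which satisfies
`θ_m - θ_k ≤ √(D / N_k)` (`gap_le_of_isTopList`).

*All rounds.* A counter grows by one at each display, so the pair `m < k` costs at most
`d_m ∑ √(D / n)` over `n ≤ D / (θ_m - θ_k)²`, that is `2 D d_m / (θ_m - θ_k)`
(`sum_shown`, `sum_sqrt_div_le`). For `k ≤ L` the swap of `m` and `k` shows that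
`Δ ≤ κ_1 (θ_m - θ_k)`; for `k > L` one uses `θ_m ≥ θ_L`. As `∑ d_m = κ_1`, the total is at most
`2 D κ_1² (L / Δ + ∑_{k > L} 1 / (κ_L (θ_L - θ_k)))` (`sum_kappaStep_div_le`). Since
`C(κ) ≥ κ_1² / κ_L²`, this is at most a quarter of the logarithmic term of the theorem.

*Concentration.* The variables `exp(s M - s² N_k / 8)`, with `M = S_k - θ_k Ñ_k`, form a
supermartingale by Hoeffding's lemma (`IsRun.expDev_spec`). Cutting the range of `N_k` into
geometric blocks and tuning `s` to each of them bounds the probability that a confidence interval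
fails in round `t` by `O(log t) t^{-(1 + ε / 2)}` (`IsRun.measureReal_badEvent_le`), which is
summable with a sum that depends on `ε` only (`exists_sum_badEvent_bound`).

*The constant.* Failures and first displays cost at most `B K` in expectation, with `B = B(ε, L)`.
If `log T ≥ B`, the unused part of the logarithmic term, at least `(K - L) log T`, absorbs
`B (K - L)`; if `log T < B`, the regret is at most `L T ≤ L exp B`.
-/

namespace PBM

/-! ### The regret of one round -/

/-- The decrement `κ_m - κ_{m+1}` of the examination probabilities, with `κ_{L+1} = 0`. -/
noncomputable def kappaStep {L : ℕ} (κ : Fin L → ℝ) (m : Fin L) : ℝ :=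
  κ m - if h : (m : ℕ) + 1 < L then κ ⟨m + 1, h⟩ else 0

lemma kappaStep_nonneg {L : ℕ} {κ : Fin L → ℝ} (hκ : StrictAnti κ) (hpos : ∀ l, 0 < κ l)
    (m : Fin L) : 0 ≤ kappaStep κ m := by
  unfold kappaStep
  split_ifs with h
  · exact sub_nonneg.2 (hκ.antitone (Fin.le_def.2 (Nat.le_succ _)))
  · simpa using (hpos m).le

lemma sum_kappaStep_Ici {L : ℕ} (κ : Fin L → ℝ) (l : Fin L) :
    ∑ m ∈ Finset.Ici l, kappaStep κ m = κ l := by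
  set κ' : ℕ → ℝ := fun i => if h : i < L then κ ⟨i, h⟩ else 0 with hκ'
  have h1 : ∀ m : Fin L, kappaStep κ m = κ' m - κ' (m + 1) := fun m => by
    simp [kappaStep, hκ']
  have h2 : ∑ m ∈ Finset.Ici l, kappaStep κ m
      = ∑ i ∈ Finset.Ico (l : ℕ) L, (κ' i - κ' (i + 1)) := by
    refine Finset.sum_bij (fun m _ => (m : ℕ)) ?_ ?_ ?_ ?_
    · intro m hm
      have := Finset.mem_Ici.1 hm
      simp only [Finset.mem_Ico]
      exact ⟨this, m.2⟩
    · intro a _ b _ h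
      exact Fin.ext h
    · intro i hi
      have := Finset.mem_Ico.1 hi
      exact ⟨⟨i, this.2⟩, Finset.mem_Ici.2 this.1, rfl⟩
    · intro m _
      exact h1 m
  have h3 : ∀ n, (l : ℕ) ≤ n → ∑ i ∈ Finset.Ico (l : ℕ) n, (κ' i - κ' (i + 1)) = κ' l - κ' n := by
    intro n hn
    induction n, hn using Nat.le_induction with
    | base => simp
    | succ n hn ih => rw [Finset.sum_Ico_succ_top hn, ih]; ring
  rw [h2, h3 L l.2.le]
  simp [hκ']

lemma sum_le_sum_of_card_eq {ι : Type*} {s t : Finset ι} (hst : s.card = t.card)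
    {f g : ι → ℝ} (h : ∀ i ∈ s, ∀ j ∈ t, f i ≤ g j) : ∑ i ∈ s, f i ≤ ∑ j ∈ t, g j := by
  rcases s.eq_empty_or_nonempty with rfl | hs
  · have : t = ∅ := by simpa using hst.symm
    simp [this]
  · calc ∑ i ∈ s, f i ≤ s.card • s.sup' hs f :=
          Finset.sum_le_card_nsmul _ _ _ fun i hi => Finset.le_sup' f hi
      _ = t.card • s.sup' hs f := by rw [hst]
      _ ≤ ∑ j ∈ t, g j := Finset.card_nsmul_le_sum _ _ _ fun j hj =>
          Finset.sup'_le _ _ fun i hi => h i hi j hj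

/-- Summation by parts: the gap of a list is a combination of the gaps of its initial segments,
seen as sets. -/
lemma gap_eq_sum_kappaStep {K L : ℕ} (hLK : L ≤ K) (κ : Fin L → ℝ) (θ : Fin K → ℝ)
    (a : Action K L) :
    gap hLK κ θ a = ∑ m, kappaStep κ m *
      ∑ l ∈ Finset.Iic m, (θ (optimalAction hLK l) - θ (a l)) := by
  have h1 : gap hLK κ θ a
      = ∑ l, ∑ m ∈ Finset.Ici l, kappaStep κ m * (θ (optimalAction hLK l) - θ (a l)) := by
    simp only [gap, meanReward, ← Finset.sum_sub_distrib, ← Finset.sum_mul, sum_kappaStep_Ici]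
    exact Finset.sum_congr rfl fun l _ => by ring
  rw [h1, Finset.sum_comm' (t' := Finset.univ) (s' := fun m => Finset.Iic m)]
  · simp only [Finset.mul_sum]
  · simp

/-- Deterministic regret bound for one round. If the indices `U` overestimate the arms, and those
of the shown arms by at most `b`, then only shown arms `k` that stand too high, ahead of a position
`m < k`, contribute, and only when their uncertainty `b k` exceeds `θ_m - θ_k`. -/
lemma gap_le_of_isTopList {K L : ℕ} (hLK : L ≤ K) {κ : Fin L → ℝ} {θ : Fin K → ℝ}
    (hκ : StrictAnti κ) (hpos : ∀ l, 0 < κ l) (hθ : StrictAnti θ) {U : Fin K → EReal}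
    {a : Action K L} (ha : IsTopList U a) {b : Fin K → ℝ} (hb : ∀ k, 0 ≤ b k)
    (hlow : ∀ k, (θ k : EReal) ≤ U k)
    (hup : ∀ l, U (a l) ≤ ((θ (a l) + b (a l) : ℝ) : EReal)) :
    gap hLK κ θ a ≤ ∑ m, kappaStep κ m * ∑ k ∈ Finset.univ.filter (optimalAction hLK m < ·),
      if (∃ l, a l = k) ∧ θ (optimalAction hLK m) - θ k ≤ b k then b k else 0 := by
  classical
  rw [gap_eq_sum_kappaStep]
  refine Finset.sum_le_sum fun m _ => mul_le_mul_of_nonneg_left ?_ (kappaStep_nonneg hκ hpos m)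
  set P := (Finset.Iic m).map (optimalAction hLK) with hP
  set Q := (Finset.Iic m).map a with hQ
  have hcard : (P \ Q).card = (Q \ P).card := by
    refine Finset.card_sdiff_comm ?_
    simp [hP, hQ]
  have hmemP : ∀ j, j ∈ P ↔ j ≤ optimalAction hLK m := by
    intro j
    simp only [hP, Finset.mem_map, Finset.mem_Iic]
    constructor
    · rintro ⟨l, hl, rfl⟩
      exact Fin.le_def.2 hl
    · intro hj
      have hj' : (j : ℕ) ≤ m := hj
      exact ⟨⟨j, hj'.trans_lt m.2⟩, hj', rfl⟩
  -- an arm outside the first `m` shown ones has a smaller index than any of these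
  have hcmp : ∀ j ∈ P \ Q, ∀ k ∈ Q \ P, θ j ≤ θ k + b k := by
    intro j hj k hk
    obtain ⟨l, hl, rfl⟩ := Finset.mem_map.1 (Finset.mem_sdiff.1 hk).1
    have hjQ := (Finset.mem_sdiff.1 hj).2
    have hU : U j ≤ U (a l) := by
      by_cases hr : j ∈ Set.range a
      · obtain ⟨l', rfl⟩ := hr
        refine ha.1 (le_of_lt ?_)
        by_contra hlt
        exact hjQ (Finset.mem_map_of_mem _
          (Finset.mem_Iic.2 ((not_lt.1 hlt).trans (Finset.mem_Iic.1 hl))))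
      · exact ha.2 j hr l
    exact EReal.coe_le_coe_iff.1 ((hlow j).trans (hU.trans (hup l)))
  have h1 : ∑ l ∈ Finset.Iic m, (θ (optimalAction hLK l) - θ (a l))
      = ∑ j ∈ P \ Q, θ j - ∑ k ∈ Q \ P, θ k := by
    rw [Finset.sum_sub_distrib, Finset.sum_sdiff_sub_sum_sdiff, hP, hQ, Finset.sum_map,
      Finset.sum_map]
  have h2 : ∑ j ∈ P \ Q, θ j ≤ ∑ k ∈ Q \ P, (θ k + b k) := sum_le_sum_of_card_eq hcard hcmp
  rw [Finset.sum_add_distrib] at h2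
  have h3 : ∑ k ∈ Q \ P, b k ≤ ∑ k ∈ Finset.univ.filter (optimalAction hLK m < ·),
      if (∃ l, a l = k) ∧ θ (optimalAction hLK m) - θ k ≤ b k then b k else 0 := by
    calc ∑ k ∈ Q \ P, b k = ∑ k ∈ Q \ P,
        if (∃ l, a l = k) ∧ θ (optimalAction hLK m) - θ k ≤ b k then b k else 0 := by
          refine Finset.sum_congr rfl fun k hk => ?_
          obtain ⟨l, -, hl⟩ := Finset.mem_map.1 (Finset.mem_sdiff.1 hk).1
          have hne : (P \ Q).Nonempty := by
            rw [← Finset.card_pos, hcard, Finset.card_pos]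
            exact ⟨k, hk⟩
          obtain ⟨j, hj⟩ := hne
          have hjm := hθ.antitone ((hmemP j).1 (Finset.mem_sdiff.1 hj).1)
          rw [if_pos ⟨⟨l, hl⟩, by linarith [hcmp j hj k hk]⟩]
      _ ≤ _ := by
          refine Finset.sum_le_sum_of_subset_of_nonneg ?_ ?_
          · intro k hk
            have := (Finset.mem_sdiff.1 hk).2
            rw [hmemP, not_le] at this
            simpa using this
          · intro k _ _
            split_ifs
            · exact hb k
            · exact le_rfl
  linarith

/-! ### Summation over the rounds -/

section Counting

variable {Ω : Type*} {K L : ℕ} (A : ℕ → Ω → Action K L)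

open Classical in
/-- The number of rounds before `t` in which arm `k` is shown, as a natural number. -/
noncomputable def shown (k : Fin K) (t : ℕ) (ω : Ω) : ℕ :=
  ((Finset.Ico 1 t).filter fun s => ∃ l, A s ω l = k).card

lemma sum_ite_action_eq (a : Action K L) (k : Fin K) (f : Fin L → ℝ) {l : Fin L} (h : a l = k) :
    ∑ i, f i * (if a i = k then 1 else 0) = f l := by
  subst h
  simp [a.injective.eq_iff]

open Classical in
lemma count_eq_shown (k : Fin K) (t : ℕ) (ω : Ω) : count A k t ω = shown A k t ω := by
  unfold count countPos shown
  rw [Finset.sum_comm, Finset.card_filter]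
  push_cast
  refine Finset.sum_congr rfl fun s _ => ?_
  split_ifs with h
  · obtain ⟨l, hl⟩ := h
    simpa using sum_ite_action_eq (A s ω) k (fun _ => 1) hl
  · push Not at h
    simp [h]

lemma shown_le (k : Fin K) (t : ℕ) (ω : Ω) : shown A k t ω ≤ t := by
  unfold shown
  refine (Finset.card_filter_le _ _).trans ?_
  simp

open Classical in
lemma shown_succ (k : Fin K) {t : ℕ} (ht : 1 ≤ t) (ω : Ω) :
    shown A k (t + 1) ω = shown A k t ω + if ∃ l, A t ω l = k then 1 else 0 := by
  unfold shown
  rw [Finset.card_filter, Finset.card_filter, Finset.sum_Ico_succ_top ht]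

open Classical in
/-- Each time an arm is shown its counter moves on by one, so that a sum over these rounds of a
function of the counter is a sum over the values of the counter. -/
lemma sum_shown (k : Fin K) (f : ℕ → ℝ) (T : ℕ) (ω : Ω) :
    ∑ t ∈ Finset.Icc 1 T, (if ∃ l, A t ω l = k then f (shown A k t ω) else 0)
      = ∑ n ∈ Finset.range (shown A k (T + 1) ω), f n := by
  induction T with
  | zero => simp [shown]
  | succ T ih =>
    rw [Finset.sum_Icc_succ_top (by omega), ih, shown_succ A k (t := T + 1) (by omega)]
    split_ifs
    · rw [Finset.sum_range_succ]
    · simp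

end Counting

lemma sum_inv_sqrt_le (n : ℕ) : ∑ i ∈ Finset.Icc 1 n, 1 / √(i : ℝ) ≤ 2 * √(n : ℝ) := by
  induction n with
  | zero => simp
  | succ n ih =>
    rw [Finset.sum_Icc_succ_top (by omega)]
    have h0 : 0 < √((n + 1 : ℕ) : ℝ) := Real.sqrt_pos.2 (by positivity)
    have h1 : √((n + 1 : ℕ) : ℝ) ^ 2 = n + 1 := by
      rw [Real.sq_sqrt (by positivity)]
      push_cast
      rfl
    have h2 : √(n : ℝ) ^ 2 = n := Real.sq_sqrt (by positivity)
    have h3 : 1 / √((n + 1 : ℕ) : ℝ) ≤ 2 * √((n + 1 : ℕ) : ℝ) - 2 * √(n : ℝ) := by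
      rw [div_le_iff₀ h0]
      nlinarith [sq_nonneg (√((n + 1 : ℕ) : ℝ) - √(n : ℝ))]
    linarith

/-- An arm whose uncertainty after `n` displays is `√(D / n)` accumulates at most `2 D / g` before
the uncertainty falls below `g`. -/
lemma sum_sqrt_div_le {D g : ℝ} (hD : 0 ≤ D) (hg : 0 < g) (M : ℕ) :
    ∑ n ∈ Finset.range M, (if 1 ≤ n ∧ g ≤ √(D / n) then √(D / n) else 0) ≤ 2 * D / g := by
  have hx : 0 ≤ D / g ^ 2 := by positivity
  rw [← Finset.sum_filter]
  calc ∑ n ∈ (Finset.range M).filter (fun n : ℕ => 1 ≤ n ∧ g ≤ √(D / n)), √(D / (n : ℝ))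
      ≤ ∑ n ∈ Finset.Icc 1 ⌊D / g ^ 2⌋₊, √(D / n) := by
        refine Finset.sum_le_sum_of_subset_of_nonneg ?_ fun _ _ _ => Real.sqrt_nonneg _
        intro n hn
        obtain ⟨-, h1, h2⟩ := Finset.mem_filter.1 hn
        have hn0 : (0 : ℝ) < n := by exact_mod_cast h1
        refine Finset.mem_Icc.2 ⟨h1, Nat.le_floor ?_⟩
        have h3 := (Real.le_sqrt' hg).1 h2
        rw [le_div_iff₀ hn0] at h3
        rw [le_div_iff₀ (by positivity)]
        linarith
    _ = √D * ∑ n ∈ Finset.Icc 1 ⌊D / g ^ 2⌋₊, 1 / √(n : ℝ) := by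
        rw [Finset.mul_sum]
        refine Finset.sum_congr rfl fun n _ => ?_
        rw [Real.sqrt_div hD]
        ring
    _ ≤ √D * (2 * (√D / g)) := by
        refine mul_le_mul_of_nonneg_left ((sum_inv_sqrt_le _).trans ?_) (Real.sqrt_nonneg _)
        refine mul_le_mul_of_nonneg_left ?_ (by norm_num)
        refine (Real.sqrt_le_sqrt (Nat.floor_le hx)).trans_eq ?_
        rw [Real.sqrt_div hD, Real.sqrt_sq hg.le]
    _ = 2 * D / g := by
        nth_rewrite 3 [← Real.mul_self_sqrt hD]
        ring

/-! ### Comparison with the problem-dependent constants -/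

/-- The rearrangement inequality, in strict form. -/
lemma gap_perm_pos {K L : ℕ} (hLK : L ≤ K) {κ : Fin L → ℝ} {θ : Fin K → ℝ}
    (hκ : StrictAnti κ) (hθ : StrictAnti θ) {σ : Equiv.Perm (Fin L)} (hσ : σ ≠ 1) :
    0 < gap hLK κ θ (σ.toEmbedding.trans (optimalAction hLK)) := by
  have hθ' : StrictAnti fun l => θ (optimalAction hLK l) := fun i j h => hθ (by
    exact Fin.lt_def.2 h)
  have hmono : Monovary κ fun l => θ (optimalAction hLK l) :=
    hκ.antitone.monovary hθ'.antitone
  have h := (hmono.sum_mul_comp_perm_lt_sum_mul_iff (σ := σ)).2 ?_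
  · simpa [gap, meanReward, sub_pos] using h
  · intro hmv
    apply hσ
    have hs : StrictMono σ := by
      have hm : Monotone σ := by
        intro i j hij
        rcases hij.eq_or_lt with rfl | hlt
        · exact le_rfl
        by_contra hc
        exact absurd (hmv (i := i) (j := j) (hθ' (not_le.1 hc))) (not_le.2 (hκ hlt))
      exact hm.strictMono_of_injective σ.injective
    have : StrictMono.orderIsoOfSurjective σ hs σ.surjective = OrderIso.refl _ :=
      Subsingleton.elim _ _
    ext i
    have := DFunLike.congr_fun this i
    simpa using congrArg Fin.val this

lemma minPermGap_nonneg {K L : ℕ} (hLK : L ≤ K) {κ : Fin L → ℝ} {θ : Fin K → ℝ}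
    (hκ : StrictAnti κ) (hθ : StrictAnti θ) : 0 ≤ minPermGap hLK κ θ :=
  Real.iInf_nonneg fun σ => (gap_perm_pos hLK hκ hθ σ.2).le

lemma minPermGap_pos {K L : ℕ} (hLK : L ≤ K) (hL : 2 ≤ L) {κ : Fin L → ℝ} {θ : Fin K → ℝ}
    (hκ : StrictAnti κ) (hθ : StrictAnti θ) : 0 < minPermGap hLK κ θ := by
  have : Nonempty {σ : Equiv.Perm (Fin L) // σ ≠ 1} := by
    have : Nontrivial (Fin L) := Fin.nontrivial_iff_two_le.2 hL
    obtain ⟨σ, hσ⟩ := exists_ne (1 : Equiv.Perm (Fin L))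
    exact ⟨⟨σ, hσ⟩⟩
  obtain ⟨σ, hσ⟩ := exists_eq_ciInf_of_finite
    (f := fun σ : {σ : Equiv.Perm (Fin L) // σ ≠ 1} =>
      gap hLK κ θ (σ.1.toEmbedding.trans (optimalAction hLK)))
  unfold minPermGap
  rw [← hσ]
  exact gap_perm_pos hLK hκ hθ σ.2

lemma minPermGap_le_swap {K L : ℕ} (hLK : L ≤ K) (κ : Fin L → ℝ) (θ : Fin K → ℝ)
    {i j : Fin L} (hij : i ≠ j) :
    minPermGap hLK κ θ ≤
      (κ i - κ j) * (θ (optimalAction hLK i) - θ (optimalAction hLK j)) := by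
  have hne : Equiv.swap i j ≠ 1 := fun h => hij (Equiv.swap_eq_one_iff.1 h)
  refine (ciInf_le (Set.finite_range _).bddBelow ⟨Equiv.swap i j, hne⟩).trans_eq ?_
  simp only [gap, meanReward, ← Finset.sum_sub_distrib]
  rw [← Finset.sum_subset (Finset.subset_univ {i, j})]
  · rw [Finset.sum_pair hij]
    simp
    ring
  · intro l _ hl
    simp only [Finset.mem_insert, Finset.mem_singleton, not_or] at hl
    simp [Equiv.swap_apply_of_ne_of_ne hl.1 hl.2]

/-- The only property of `C(κ)` that the regret bound needs. -/
lemma kappa_sq_div_le_kappaConst {L : ℕ} (hL : 0 < L) {κ : Fin L → ℝ} (hpos : ∀ l, 0 < κ l) :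
    κ ⟨0, hL⟩ ^ 2 / κ (lastPos hL) ^ 2 ≤ kappaConst hL κ := by
  have : Nonempty (Fin L) := ⟨⟨0, hL⟩⟩
  refine le_ciInf fun l => ?_
  gcongr
  have h1 : κ ⟨0, hL⟩ ≤ ∑ j ∈ Finset.Iic l, κ j :=
    Finset.single_le_sum (f := κ) (fun j _ => (hpos j).le)
      (Finset.mem_Iic.2 (Fin.le_def.2 (Nat.zero_le _)))
  have h2 : κ ⟨0, hL⟩ ^ 2 ≤ (∑ j ∈ Finset.Iic l, κ j) ^ 2 := pow_le_pow_left₀ (hpos _).le h1 2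
  have h3 : 0 ≤ (∑ j, κ j) ^ 2 / ((l : ℕ) + 1 : ℝ) := by positivity
  linarith

/-- The total contribution of the pairs `m < k`. An optimal arm `k` is paid for by the swap of
`m` and `k`, whose gap is at least `Δ`. -/
lemma sum_kappaStep_div_le {K L : ℕ} (hL : 0 < L) (hLK : L ≤ K) {κ : Fin L → ℝ} {θ : Fin K → ℝ}
    (hκ : StrictAnti κ) (hpos : ∀ l, 0 < κ l) (hθ : StrictAnti θ) :
    ∑ m, kappaStep κ m * ∑ k ∈ Finset.univ.filter (optimalAction hLK m < ·),
        1 / (θ (optimalAction hLK m) - θ k) ≤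
      κ ⟨0, hL⟩ ^ 2 * (permTerm hLK κ θ +
        ∑ k ∈ Finset.univ.filter (fun k : Fin K => k ∉ Set.range (optimalAction hLK)),
          1 / (κ (lastPos hL) * (θ (optimalAction hLK (lastPos hL)) - θ k))) := by
  classical
  set κ₁ := κ ⟨0, hL⟩ with hκ₁
  have hκ₁pos : 0 < κ₁ := hpos _
  have hsum : ∑ m, kappaStep κ m = κ₁ := by
    rw [hκ₁, ← sum_kappaStep_Ici κ ⟨0, hL⟩]
    refine Finset.sum_congr ?_ fun _ _ => rfl
    ext m
    simp [Fin.le_def]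
  have hlast : ∀ l : Fin L, l ≤ lastPos hL := fun l => Fin.le_def.2 (by
    have := l.2
    simp only [lastPos]
    omega)
  have hout : ∀ {k : Fin K}, k ∉ Set.range (optimalAction hLK) →
      optimalAction hLK (lastPos hL) < k := by
    intro k hk
    refine Fin.lt_def.2 ?_
    by_contra h
    refine hk ⟨⟨k, ?_⟩, rfl⟩
    have h' : (k : ℕ) ≤ L - 1 := not_lt.1 h
    omega
  set P := permTerm hLK κ θ with hP
  set N := Finset.univ.filter (fun k : Fin K => k ∉ Set.range (optimalAction hLK)) with hN
  set R := ∑ k ∈ N, 1 / (κ (lastPos hL) * (θ (optimalAction hLK (lastPos hL)) - θ k)) with hR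
  have key : ∀ m, ∑ k ∈ Finset.univ.filter (optimalAction hLK m < ·),
      1 / (θ (optimalAction hLK m) - θ k) ≤ κ₁ * (P + R) := by
    intro m
    rw [← Finset.sum_filter_add_sum_filter_not _ (fun k : Fin K => k ∈ Set.range (optimalAction hLK)),
      mul_add]
    refine add_le_add ?_ ?_
    · have hterm : ∀ k ∈ (Finset.univ.filter (optimalAction hLK m < ·)).filter
          (fun k : Fin K => k ∈ Set.range (optimalAction hLK)),
          1 / (θ (optimalAction hLK m) - θ k) ≤ κ₁ / minPermGap hLK κ θ := by
        intro k hk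
        simp only [Finset.mem_filter, Finset.mem_univ, true_and] at hk
        obtain ⟨hmk, j, rfl⟩ := hk
        have hmj : m < j := Fin.lt_def.2 hmk
        have hL2 : 2 ≤ L := by
          have := j.2
          have : (m : ℕ) < j := hmj
          omega
        have hgap : 0 < θ (optimalAction hLK m) - θ (optimalAction hLK j) := sub_pos.2 (hθ hmk)
        rw [div_le_div_iff₀ hgap (minPermGap_pos hLK hL2 hκ hθ), one_mul]
        refine (minPermGap_le_swap hLK κ θ hmj.ne).trans
          (mul_le_mul_of_nonneg_right ?_ hgap.le)
        have : κ m ≤ κ₁ := hκ.antitone (Fin.le_def.2 (Nat.zero_le _))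
        linarith [hpos j]
      by_cases hL2 : 2 ≤ L
      · refine (Finset.sum_le_card_nsmul _ _ _ hterm).trans ?_
        have hc : ((Finset.univ.filter (optimalAction hLK m < ·)).filter
          (fun k : Fin K => k ∈ Set.range (optimalAction hLK))).card ≤ L := by
          calc _ ≤ (Finset.univ.map (optimalAction hLK)).card := Finset.card_le_card (by
                intro k hk
                simp only [Finset.mem_filter, Finset.mem_univ, true_and] at hk
                simpa using hk.2)
            _ = L := by simp
        rw [nsmul_eq_mul, hP, permTerm, if_pos hL2]
        have hM := minPermGap_pos hLK hL2 hκ hθ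
        calc _ ≤ (L : ℝ) * (κ₁ / minPermGap hLK κ θ) := by gcongr
          _ = _ := by ring
      · rw [hP, permTerm, if_neg hL2, mul_zero]
        refine le_of_eq (Finset.sum_eq_zero fun k hk => ?_)
        simp only [Finset.mem_filter, Finset.mem_univ, true_and] at hk
        obtain ⟨hmk, j, rfl⟩ := hk
        have hmj : (m : ℕ) < j := Fin.lt_def.2 hmk
        have := j.2
        omega
    · rw [hR, Finset.mul_sum]
      calc _ ≤ ∑ k ∈ N, 1 / (θ (optimalAction hLK m) - θ k) := by
            refine Finset.sum_le_sum_of_subset_of_nonneg ?_ ?_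
            · intro k hk
              rw [Finset.mem_filter] at hk
              simpa [hN] using hk.2
            · intro k hk _
              have h1 := hout (Finset.mem_filter.1 hk).2
              have h2 : optimalAction hLK m ≤ optimalAction hLK (lastPos hL) := hlast m
              exact one_div_nonneg.2 (sub_nonneg.2 (hθ.antitone (h2.trans h1.le)))
        _ ≤ _ := by
            refine Finset.sum_le_sum fun k hk => ?_
            have h1 := hθ (hout (Finset.mem_filter.1 hk).2)
            have h2 : θ (optimalAction hLK (lastPos hL)) ≤ θ (optimalAction hLK m) :=
              hθ.antitone (hlast m)
            have h3 : κ (lastPos hL) ≤ κ₁ := hκ.antitone (Fin.le_def.2 (Nat.zero_le _))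
            rw [mul_one_div, div_le_div_iff₀ (by linarith)
              (mul_pos (hpos _) (by linarith)), one_mul]
            exact mul_le_mul h3 (by linarith) (by linarith) hκ₁pos.le
  calc _ ≤ ∑ m, kappaStep κ m * (κ₁ * (P + R)) :=
        Finset.sum_le_sum fun m _ => mul_le_mul_of_nonneg_left (key m) (kappaStep_nonneg hκ hpos m)
    _ = κ₁ ^ 2 * (P + R) := by rw [← Finset.sum_mul, hsum]; ring

/-! ### Deviations of the click counts -/

section Deviations

variable {Ω : Type*} {K L : ℕ}

lemma obs_mem_Icc (X Y : ℕ → Ω → Fin L → Bool) (t : ℕ) (l : Fin L) (ω : Ω) :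
    0 ≤ obs X Y t l ω ∧ obs X Y t l ω ≤ 1 := by
  unfold obs
  split_ifs <;> simp

/-- The deviation `S_k(t) - θ_k Ñ_k(t)` of the number of clicks on arm `k` from its
predictable part. -/
noncomputable def deviation (κ : Fin L → ℝ) (θ : Fin K → ℝ) (A : ℕ → Ω → Action K L)
    (X Y : ℕ → Ω → Fin L → Bool) (k : Fin K) (t : ℕ) (ω : Ω) : ℝ :=
  clicks A X Y k t ω - θ k * wcount κ A k t ω

/-- The Hoeffding supermartingale `exp(s M - s² N / 8)` of arm `k`, where `M` is the deviation and
`N` the counter of the arm. -/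
noncomputable def expDev (κ : Fin L → ℝ) (θ : Fin K → ℝ) (A : ℕ → Ω → Action K L)
    (X Y : ℕ → Ω → Fin L → Bool) (k : Fin K) (s : ℝ) (t : ℕ) (ω : Ω) : ℝ :=
  Real.exp (s * deviation κ θ A X Y k t ω - s ^ 2 / 8 * count A k t ω)

lemma deviation_succ (κ : Fin L → ℝ) (θ : Fin K → ℝ) (A : ℕ → Ω → Action K L)
    (X Y : ℕ → Ω → Fin L → Bool) (k : Fin K) {t : ℕ} (ht : 1 ≤ t) (ω : Ω) :
    deviation κ θ A X Y k (t + 1) ω = deviation κ θ A X Y k t ω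
      + ∑ l, (obs X Y t l ω - θ k * κ l) * (if A t ω l = k then 1 else 0) := by
  simp only [deviation, clicks, wcount, countPos, Finset.sum_Ico_succ_top ht, mul_add,
    Finset.sum_add_distrib, sub_mul, Finset.sum_sub_distrib, Finset.mul_sum]
  simp only [mul_assoc]
  ring

lemma count_succ (A : ℕ → Ω → Action K L) (k : Fin K) {t : ℕ} (ht : 1 ≤ t) (ω : Ω) :
    count A k (t + 1) ω = count A k t ω + ∑ l, (if A t ω l = k then 1 else 0) := by
  simp only [count, countPos, Finset.sum_Ico_succ_top ht, Finset.sum_add_distrib]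

/-- An observation takes the values `0` and `1` only, so that the factor by which `expDev` grows
in one round is affine in the observation. -/
lemma expDev_succ (κ : Fin L → ℝ) (θ : Fin K → ℝ) (A : ℕ → Ω → Action K L)
    (X Y : ℕ → Ω → Fin L → Bool) (k : Fin K) (s : ℝ) {t : ℕ} (ht : 1 ≤ t) (ω : Ω) :
    expDev κ θ A X Y k s (t + 1) ω = expDev κ θ A X Y k s t ω +
      ∑ l, (expDev κ θ A X Y k s t ω * (if A t ω l = k then 1 else 0)) *
        ((Real.exp (-s * (κ l * θ k) - s ^ 2 / 8) - 1) +
          Real.exp (-s * (κ l * θ k) - s ^ 2 / 8) * (Real.exp s - 1) * obs X Y t l ω) := by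
  rw [expDev, deviation_succ κ θ A X Y k ht, count_succ A k ht]
  by_cases h : ∃ l, A t ω l = k
  · obtain ⟨l, hl⟩ := h
    have hsum : ∀ f : Fin L → ℝ, ∑ i, f i * (if A t ω i = k then 1 else 0) = f l :=
      fun f => sum_ite_action_eq _ _ f hl
    have h1 : ∑ i, (if A t ω i = k then (1 : ℝ) else 0) = 1 := by simpa using hsum fun _ => 1
    have h2 : ∀ V : ℝ, ∀ f : Fin L → ℝ,
        ∑ i, V * (if A t ω i = k then 1 else 0) * f i = V * f l := by
      intro V f
      rw [← hsum fun i => V * f i]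
      exact Finset.sum_congr rfl fun i _ => by ring
    rw [hsum, h1, h2, expDev]
    have h3 : Real.exp (s * (deviation κ θ A X Y k t ω + (obs X Y t l ω - θ k * κ l))
        - s ^ 2 / 8 * (count A k t ω + 1))
        = Real.exp (s * deviation κ θ A X Y k t ω - s ^ 2 / 8 * count A k t ω) *
          (Real.exp (-s * (κ l * θ k) - s ^ 2 / 8) * Real.exp (s * obs X Y t l ω)) := by
      rw [← Real.exp_add, ← Real.exp_add]
      ring_nf
    have h4 : Real.exp (s * obs X Y t l ω) = 1 + (Real.exp s - 1) * obs X Y t l ω := by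
      unfold obs
      split_ifs <;> simp
    rw [h3, h4]
    ring
  · push Not at h
    simp [h, expDev]

/-- The event that, before round `t`, arm `k` has been shown and its estimate `S_k / Ñ_k` is
off by more than the confidence radius. -/
def badEvent (κ : Fin L → ℝ) (θ : Fin K → ℝ) (A : ℕ → Ω → Action K L)
    (X Y : ℕ → Ω → Fin L → Bool) (δ : ℝ) (k : Fin K) (t : ℕ) : Set Ω :=
  {ω | 1 ≤ shown A k t ω ∧ √(shown A k t ω * δ / 2) < |deviation κ θ A X Y k t ω|}

/-- If the counter of an arm lies in `[v², (r v)²]`, the tilting parameter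
`√(8 δ) / v`, which is optimal for the counter `v²`, loses a factor `1 - (r - 1)²` only. -/
lemma le_expDev_of_mem_block {δ d n v r : ℝ} (hδ : 0 ≤ δ) (hv : 0 < v)
    (h1 : v ≤ √n) (h2 : √n ≤ r * v) (hn : 0 ≤ n) (hd : √(n * δ / 2) ≤ d) :
    δ * (1 - (r - 1) ^ 2) ≤ (√(8 * δ) / v) * d - (√(8 * δ) / v) ^ 2 / 8 * n := by
  set u := √n / v with hu
  have hu1 : 1 ≤ u := (one_le_div₀ hv).2 h1
  have hur : u ≤ r := (div_le_iff₀ hv).2 h2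
  have e1 : (√(8 * δ) / v) * √(n * δ / 2) = 2 * δ * u := by
    have : √(8 * δ) * √(n * δ / 2) = 2 * δ * √n := by
      rw [← Real.sqrt_mul (by positivity), show 8 * δ * (n * δ / 2) = (2 * δ) ^ 2 * n by ring,
        Real.sqrt_mul (by positivity), Real.sqrt_sq (by positivity)]
    rw [div_mul_eq_mul_div, this, hu]
    ring
  have e2 : (√(8 * δ) / v) ^ 2 / 8 * n = δ * u ^ 2 := by
    rw [hu, div_pow, div_pow, Real.sq_sqrt (by positivity), Real.sq_sqrt hn]
    ring
  have h3 : (√(8 * δ) / v) * √(n * δ / 2) ≤ (√(8 * δ) / v) * d :=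
    mul_le_mul_of_nonneg_left hd (by positivity)
  rw [e1] at h3
  rw [e2]
  have h4 : (u - 1) ^ 2 ≤ (r - 1) ^ 2 := by
    apply pow_le_pow_left₀ <;> linarith
  nlinarith [mul_le_mul_of_nonneg_left h4 hδ]

/-- On the bad event the counter lies in one of `O(log t)` blocks `[r^(2j), r^(2j+2))`, and one of
the two supermartingales tuned to this block is large. -/
lemma badEvent_subset (κ : Fin L → ℝ) (θ : Fin K → ℝ) (A : ℕ → Ω → Action K L)
    (X Y : ℕ → Ω → Fin L → Bool) {δ r : ℝ} (hδ : 0 ≤ δ) (hr : 1 < r) (k : Fin K) (t : ℕ) :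
    badEvent κ θ A X Y δ k t ⊆
      ⋃ j ∈ Finset.range (⌊Real.log t / (2 * Real.log r)⌋₊ + 1),
        ({ω | Real.exp (δ * (1 - (r - 1) ^ 2)) ≤ expDev κ θ A X Y k (√(8 * δ) / r ^ j) t ω} ∪
          {ω | Real.exp (δ * (1 - (r - 1) ^ 2)) ≤
            expDev κ θ A X Y k (-(√(8 * δ) / r ^ j)) t ω}) := by
  rintro ω ⟨hn, hd⟩
  set n := shown A k t ω with hndef
  have hn1 : (1 : ℝ) ≤ n := by exact_mod_cast hn
  have hsq : (1 : ℝ) ≤ √n := Real.one_le_sqrt.2 hn1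
  obtain ⟨j, hj1, hj2⟩ := exists_nat_pow_near hsq hr
  have hr0 : (0 : ℝ) < r := by linarith
  have hv : 0 < r ^ j := by positivity
  have hlog : 0 < Real.log r := Real.log_pos hr
  have hjle : j ≤ ⌊Real.log t / (2 * Real.log r)⌋₊ := by
    refine Nat.le_floor ?_
    rw [le_div_iff₀ (by positivity)]
    have h1 : (r ^ j) ^ 2 ≤ (t : ℝ) := by
      calc (r ^ j) ^ 2 ≤ √n ^ 2 := pow_le_pow_left₀ hv.le hj1 2
        _ = n := Real.sq_sqrt (by positivity)
        _ ≤ t := by exact_mod_cast shown_le A k t ω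
    have h2 := Real.log_le_log (by positivity) h1
    rw [Real.log_pow, Real.log_pow] at h2
    push_cast at h2
    linarith
  have key : ∀ d, √(n * δ / 2) ≤ d →
      δ * (1 - (r - 1) ^ 2) ≤ (√(8 * δ) / r ^ j) * d - (√(8 * δ) / r ^ j) ^ 2 / 8 * n :=
    fun d hd => le_expDev_of_mem_block hδ hv hj1 (by rw [pow_succ] at hj2; linarith)
      (by positivity) hd
  simp only [Set.mem_iUnion, Finset.mem_range]
  refine ⟨j, by omega, ?_⟩
  rcases le_abs'.1 hd.le with h | h
  · right
    simp only [Set.mem_ofPred_eq, expDev, count_eq_shown]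
    refine Real.exp_le_exp.2 ((key _ (le_neg.1 h)).trans (le_of_eq ?_))
    rw [neg_sq]
    ring
  · left
    simp only [Set.mem_ofPred_eq, expDev, count_eq_shown]
    exact Real.exp_le_exp.2 (key _ h)

end Deviations

/-! ### Conditional law of the observations -/

lemma sum_bern (p : ℝ) : ∑ b, bern p b = 1 := by
  simp [bern]

/-- The marginal at `l` of a product of Bernoulli laws. -/
lemma sum_ite_prod_bern {L : ℕ} (p : Fin L → ℝ) (l : Fin L) :
    ∑ x : Fin L → Bool, (if x l = true then ∏ i, bern (p i) (x i) else 0) = p l := by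
  have h1 : ∀ x : Fin L → Bool, (if x l = true then ∏ i, bern (p i) (x i) else 0)
      = ∏ i, (if i = l ∧ x i = false then 0 else bern (p i) (x i)) := by
    intro x
    split_ifs with h
    · refine Finset.prod_congr rfl fun i _ => ?_
      rw [if_neg]
      rintro ⟨rfl, h'⟩
      simp [h] at h'
    · have h' : x l = false := by simpa using h
      exact (Finset.prod_eq_zero (Finset.mem_univ l) (by simp [h'])).symm
  have h2 : ∀ i, ∑ b : Bool, (if i = l ∧ b = false then 0 else bern (p i) b)
      = if i = l then p l else 1 := by
    intro i
    by_cases h : i = l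
    · subst h
      simp [bern]
    · simpa [h] using sum_bern (p i)
  simp only [h1]
  rw [← Fintype.prod_sum (f := fun i b => if i = l ∧ b = false then 0 else bern (p i) b)]
  simp only [h2]
  simp

section Probability

variable {Ω : Type*} {K L : ℕ} [mΩ : MeasurableSpace Ω] {μ : Measure Ω}
  {ℱ : Filtration ℕ mΩ} {κ : Fin L → ℝ} {θ : Fin K → ℝ} {A : ℕ → Ω → Action K L}
  {X Y : ℕ → Ω → Fin L → Bool}

/-- Any function of the next action is known to the learner. -/
lemma IsRun.measurable_comp_action (h : IsRun μ ℱ κ θ A X Y) (t : ℕ) (g : Action K L → ℝ) :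
    Measurable[ℱ t] fun ω => g (A (t + 1) ω) := by
  classical
  have : (fun ω => g (A (t + 1) ω))
      = fun ω => ∑ a, Set.indicator {ω | A (t + 1) ω = a} (fun _ => g a) ω := by
    ext ω
    simp [Set.indicator_apply]
  rw [this]
  exact Finset.measurable_fun_sum _ fun a _ =>
    measurable_const.indicator (h.action_predictable t a)

variable [IsProbabilityMeasure μ]

lemma IsRun.integrable_obs (h : IsRun μ ℱ κ θ A X Y) (t : ℕ) (l : Fin L) :
    Integrable (obs X Y (t + 1) l) μ := by
  refine Integrable.of_bound ((h.obs_adapted t l).mono (ℱ.le _) le_rfl).aestronglyMeasurable 1 ?_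
  filter_upwards with ω
  rw [Real.norm_eq_abs, abs_le]
  have := obs_mem_Icc X Y (t + 1) l ω
  constructor <;> linarith

/-- Given the past, the observation at position `l` has mean `κ_l θ_{A_l}`. -/
lemma IsRun.condExp_obs (h : IsRun μ ℱ κ θ A X Y) (t : ℕ) (l : Fin L) :
    μ[obs X Y (t + 1) l | ℱ t] =ᵐ[μ] fun ω => κ l * θ (A (t + 1) ω l) := by
  classical
  set S : Finset ((Fin L → Bool) × (Fin L → Bool)) :=
    Finset.univ.filter fun z => z.1 l = true ∧ z.2 l = true with hS
  set f : (Fin L → Bool) × (Fin L → Bool) → Ω → ℝ := fun z =>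
    Set.indicator {ω | X (t + 1) ω = z.1 ∧ Y (t + 1) ω = z.2} (fun _ => (1 : ℝ)) with hf
  have hobs : obs X Y (t + 1) l = ∑ z ∈ S, f z := by
    ext ω
    have : ∀ z : (Fin L → Bool) × (Fin L → Bool), f z ω
        = if (X (t + 1) ω, Y (t + 1) ω) = z then 1 else 0 := by
      intro z
      simp [hf, Set.indicator_apply, Prod.ext_iff]
    simp [this, obs, hS]
  have hmeas : ∀ z : (Fin L → Bool) × (Fin L → Bool),
      MeasurableSet {ω | X (t + 1) ω = z.1 ∧ Y (t + 1) ω = z.2} := fun z =>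
    ((h.measurable_X _) (measurableSet_singleton z.1)).inter
      ((h.measurable_Y _) (measurableSet_singleton z.2))
  have hint : ∀ z, Integrable (f z) μ := fun z => (integrable_const 1).indicator (hmeas z)
  have hall : ∀ᵐ ω ∂μ, ∀ z, (μ[f z | ℱ t]) ω
      = ∏ i, bern (θ (A (t + 1) ω i)) (z.1 i) * bern (κ i) (z.2 i) :=
    ae_all_iff.2 fun z => h.feedback_law t z.1 z.2
  rw [hobs]
  refine (condExp_finsetSum (fun z _ => hint z) (ℱ t)).trans ?_
  filter_upwards [hall] with ω hω
  rw [Finset.sum_apply]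
  simp only [hω]
  calc ∑ z ∈ S, ∏ i, bern (θ (A (t + 1) ω i)) (z.1 i) * bern (κ i) (z.2 i)
      = ∑ x : Fin L → Bool, ∑ y : Fin L → Bool,
        (if x l = true then ∏ i, bern (θ (A (t + 1) ω i)) (x i) else 0) *
          (if y l = true then ∏ i, bern (κ i) (y i) else 0) := by
        rw [hS, Finset.sum_filter, ← Finset.univ_product_univ, Finset.sum_product]
        refine Finset.sum_congr rfl fun x _ => Finset.sum_congr rfl fun y _ => ?_
        by_cases hx : x l = true <;> by_cases hy : y l = true <;>
          simp [hx, hy, Finset.prod_mul_distrib]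
    _ = κ l * θ (A (t + 1) ω l) := by
        rw [← Finset.sum_mul_sum, sum_ite_prod_bern (fun i => θ (A (t + 1) ω i)) l,
          sum_ite_prod_bern κ l, mul_comm]

lemma IsRun.integral_mul_obs (h : IsRun μ ℱ κ θ A X Y) (t : ℕ) (l : Fin L) {W : Ω → ℝ}
    (hW : Measurable[ℱ t] W) {C : ℝ} (hC : ∀ ω, |W ω| ≤ C) :
    ∫ ω, W ω * obs X Y (t + 1) l ω ∂μ = ∫ ω, W ω * (κ l * θ (A (t + 1) ω l)) ∂μ := by
  have h1 := condExp_stronglyMeasurable_mul_of_bound (μ := μ) (ℱ.le t) hW.stronglyMeasurable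
    (h.integrable_obs t l) C (Filter.Eventually.of_forall hC)
  calc ∫ ω, W ω * obs X Y (t + 1) l ω ∂μ = ∫ ω, (μ[W * obs X Y (t + 1) l | ℱ t]) ω ∂μ :=
        (integral_condExp (ℱ.le t)).symm
    _ = _ := by
        refine integral_congr_ae ?_
        filter_upwards [h1, h.condExp_obs t l] with ω e1 e2
        rw [e1, Pi.mul_apply, e2]

/-! ### Concentration of the click counts -/

/-- Hoeffding's lemma for a Bernoulli variable. -/
lemma exp_bernoulli_le {p : ℝ} (h0 : 0 ≤ p) (h1 : p ≤ 1) (s : ℝ) :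
    Real.exp (-s * p) * (1 + (Real.exp s - 1) * p) ≤ Real.exp (s ^ 2 / 8) := by
  open ProbabilityTheory in
  have h := (hasSubgaussianMGF_of_mem_Icc (X := id) (a := 0) (b := 1)
    (μ := bernoulliMeasure (1 : ℝ) 0 ⟨p, h0, h1⟩) aemeasurable_id (by
      rw [bernoulliMeasure_def]
      simp only [ae_iff, Measure.add_apply, Measure.smul_apply]
      rw [Measure.dirac_apply' _ (by measurability), Measure.dirac_apply' _ (by measurability)]
      simp)).mgf_le s
  simp only [ProbabilityTheory.mgf, ProbabilityTheory.integral_bernoulliMeasure] at h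
  simp at h
  refine le_trans (le_of_eq ?_) (h.trans (le_of_eq ?_))
  · have e1 : Real.exp (s * (1 - p)) = Real.exp (-s * p) * Real.exp s := by
      rw [← Real.exp_add]; ring_nf
    have e2 : Real.exp (-(s * p)) = Real.exp (-s * p) := by ring_nf
    rw [e1, e2]; ring
  · ring_nf

/-- `expDev` at time `t + 1` is known after round `t`, bounded, and of mean at most `1`. -/
lemma IsRun.expDev_spec (h : IsRun μ ℱ κ θ A X Y) (hκ : ∀ l, 0 < κ l ∧ κ l ≤ 1)
    (hθ : ∀ k, 0 < θ k ∧ θ k < 1) (k : Fin K) (s : ℝ) (t : ℕ) :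
    Measurable[ℱ t] (expDev κ θ A X Y k s (t + 1)) ∧
      (∃ C, ∀ ω, |expDev κ θ A X Y k s (t + 1) ω| ≤ C) ∧
      ∫ ω, expDev κ θ A X Y k s (t + 1) ω ∂μ ≤ 1 := by
  induction t with
  | zero =>
    have : expDev κ θ A X Y k s 1 = fun _ => 1 := by
      ext ω
      simp [expDev, deviation, clicks, wcount, count, countPos]
    rw [zero_add, this]
    exact ⟨measurable_const, ⟨1, by simp⟩, by simp⟩
  | succ t ih =>
    obtain ⟨hm, ⟨C, hC⟩, hint⟩ := ih
    set V := expDev κ θ A X Y k s (t + 1) with hV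
    set α : Fin L → ℝ := fun l => Real.exp (-s * (κ l * θ k) - s ^ 2 / 8) with hα
    set I : Fin L → Ω → ℝ := fun l ω => if A (t + 1) ω l = k then 1 else 0 with hI
    have hC0 : ∀ ω, 0 ≤ C := fun ω => (abs_nonneg _).trans (hC ω)
    have hVpos : ∀ ω, 0 ≤ V ω := fun ω => (Real.exp_pos _).le
    have hstep : ∀ ω, expDev κ θ A X Y k s (t + 1 + 1) ω = V ω +
        ∑ l, (V ω * I l ω) * ((α l - 1) + α l * (Real.exp s - 1) * obs X Y (t + 1) l ω) :=
      fun ω => expDev_succ κ θ A X Y k s (by omega) ω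
    have hI01 : ∀ l ω, |I l ω| ≤ 1 := by
      intro l ω
      simp only [hI]
      split_ifs <;> simp
    have hIm : ∀ l, Measurable[ℱ t] (I l) := fun l =>
      h.measurable_comp_action t fun a => if a l = k then 1 else 0
    have hVIm : ∀ l, Measurable[ℱ t] fun ω => V ω * I l ω := fun l => hm.mul (hIm l)
    have hVIb : ∀ l ω, |V ω * I l ω| ≤ C := by
      intro l ω
      rw [abs_mul]
      calc |V ω| * |I l ω| ≤ C * 1 := mul_le_mul (hC ω) (hI01 l ω) (abs_nonneg _) (hC0 ω)
        _ = C := mul_one C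
    have hVI : ∀ l, Integrable (fun ω => V ω * I l ω) μ := fun l =>
      Integrable.of_bound ((hVIm l).mono (ℱ.le t) le_rfl).aestronglyMeasurable C
        (Filter.Eventually.of_forall (hVIb l))
    have hVint : Integrable V μ :=
      Integrable.of_bound (hm.mono (ℱ.le t) le_rfl).aestronglyMeasurable C
        (Filter.Eventually.of_forall hC)
    have hVIobs : ∀ l, Integrable (fun ω => V ω * I l ω * obs X Y (t + 1) l ω) μ := fun l =>
      (h.integrable_obs t l).bdd_mul
        ((hVIm l).mono (ℱ.le t) le_rfl).aestronglyMeasurable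
        (Filter.Eventually.of_forall (hVIb l))
    refine ⟨?_, ⟨C + ∑ l, C * (|α l - 1| + |α l * (Real.exp s - 1)|), ?_⟩, ?_⟩
    · rw [show expDev κ θ A X Y k s (t + 1 + 1) = _ from funext hstep]
      have hle : ℱ t ≤ ℱ (t + 1) := ℱ.mono (Nat.le_succ t)
      refine (hm.mono hle le_rfl).add (Finset.measurable_fun_sum _ fun l _ => ?_)
      exact ((hVIm l).mono hle le_rfl).mul
        (measurable_const.add (measurable_const.mul (h.obs_adapted t l)))
    · intro ω
      rw [hstep]
      refine (abs_add_le _ _).trans (add_le_add (hC ω) ?_)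
      refine (Finset.abs_sum_le_sum_abs _ _).trans (Finset.sum_le_sum fun l _ => ?_)
      rw [abs_mul]
      refine mul_le_mul (hVIb l ω) ((abs_add_le _ _).trans ?_) (abs_nonneg _) (hC0 ω)
      refine add_le_add le_rfl ?_
      rw [abs_mul]
      have := obs_mem_Icc X Y (t + 1) l ω
      rw [abs_of_nonneg this.1]
      exact mul_le_of_le_one_right (abs_nonneg _) this.2
    · have hterm : ∀ l, Integrable (fun ω => (V ω * I l ω) *
          ((α l - 1) + α l * (Real.exp s - 1) * obs X Y (t + 1) l ω)) μ := by
        intro l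
        have := ((hVI l).mul_const (α l - 1)).add
          ((hVIobs l).mul_const (α l * (Real.exp s - 1)))
        refine this.congr (Filter.Eventually.of_forall fun ω => ?_)
        simp only [Pi.add_apply]
        ring
      have hle : ∀ l, ∫ ω, (V ω * I l ω) *
          ((α l - 1) + α l * (Real.exp s - 1) * obs X Y (t + 1) l ω) ∂μ ≤ 0 := by
        intro l
        have hsplit : ∀ ω, (V ω * I l ω) *
            ((α l - 1) + α l * (Real.exp s - 1) * obs X Y (t + 1) l ω)
            = (V ω * I l ω) * (α l - 1) +
              (α l * (Real.exp s - 1)) * (V ω * I l ω * obs X Y (t + 1) l ω) := fun ω => by ring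
        simp only [hsplit]
        rw [integral_add ((hVI l).mul_const _) ((hVIobs l).const_mul _), integral_const_mul,
          h.integral_mul_obs t l (hVIm l) (hVIb l)]
        have hθint : Integrable (fun ω => V ω * I l ω * (κ l * θ (A (t + 1) ω l))) μ := by
          have hg := (h.measurable_comp_action t fun a => κ l * θ (a l))
          refine Integrable.of_bound
            (((hVIm l).mul hg).mono (ℱ.le t) le_rfl).aestronglyMeasurable (C * 1) ?_
          refine Filter.Eventually.of_forall fun ω => ?_
          rw [Real.norm_eq_abs, abs_mul]
          refine mul_le_mul (hVIb l ω) ?_ (abs_nonneg _) (hC0 ω)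
          have h1 := hκ l
          have h2 := hθ (A (t + 1) ω l)
          rw [abs_of_nonneg (mul_nonneg h1.1.le h2.1.le)]
          exact mul_le_one₀ h1.2 h2.1.le h2.2.le
        rw [← integral_const_mul, ← integral_add ((hVI l).mul_const _) (hθint.const_mul _)]
        refine integral_nonpos fun ω => ?_
        simp only [hI, Pi.zero_apply]
        split_ifs with hk
        · rw [hk]
          have hp0 : 0 ≤ κ l * θ k := mul_nonneg (hκ l).1.le (hθ k).1.le
          have hp1 : κ l * θ k ≤ 1 := mul_le_one₀ (hκ l).2 (hθ k).1.le (hθ k).2.le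
          have hb := exp_bernoulli_le hp0 hp1 s
          have hα1 : α l * (1 + (Real.exp s - 1) * (κ l * θ k)) ≤ 1 := by
            have e : α l = Real.exp (-s * (κ l * θ k)) * Real.exp (-(s ^ 2 / 8)) := by
              simp only [hα]
              rw [← Real.exp_add, sub_eq_add_neg]
            calc _ = Real.exp (-s * (κ l * θ k)) * (1 + (Real.exp s - 1) * (κ l * θ k)) *
                  Real.exp (-(s ^ 2 / 8)) := by rw [e]; ring
              _ ≤ Real.exp (s ^ 2 / 8) * Real.exp (-(s ^ 2 / 8)) := by gcongr
              _ = 1 := by rw [← Real.exp_add]; simp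
          nlinarith [mul_nonneg (hVpos ω) (sub_nonneg.2 hα1)]
        · simp
      simp only [hstep]
      rw [integral_add hVint (integrable_finsetSum _ fun l _ => hterm l),
        integral_finsetSum _ fun l _ => hterm l]
      have := Finset.sum_nonpos fun l (_ : l ∈ Finset.univ) => hle l
      linarith

lemma IsRun.measureReal_expDev_ge_le (h : IsRun μ ℱ κ θ A X Y) (hκ : ∀ l, 0 < κ l ∧ κ l ≤ 1)
    (hθ : ∀ k, 0 < θ k ∧ θ k < 1) (k : Fin K) (s : ℝ) (t : ℕ) (x : ℝ) :
    μ.real {ω | Real.exp x ≤ expDev κ θ A X Y k s (t + 1) ω} ≤ Real.exp (-x) := by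
  obtain ⟨hm, ⟨C, hC⟩, hint⟩ := h.expDev_spec hκ hθ k s t
  have hVint : Integrable (expDev κ θ A X Y k s (t + 1)) μ :=
    Integrable.of_bound (hm.mono (ℱ.le t) le_rfl).aestronglyMeasurable C
      (Filter.Eventually.of_forall hC)
  have hpos : 0 ≤ᵐ[μ] expDev κ θ A X Y k s (t + 1) :=
    Filter.Eventually.of_forall fun ω => (Real.exp_pos _).le
  have := mul_meas_ge_le_integral_of_nonneg hpos hVint (Real.exp x)
  rw [Real.exp_neg, ← one_div, le_div_iff₀ (Real.exp_pos x)]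
  linarith

lemma IsRun.measureReal_badEvent_le (h : IsRun μ ℱ κ θ A X Y) (hκ : ∀ l, 0 < κ l ∧ κ l ≤ 1)
    (hθ : ∀ k, 0 < θ k ∧ θ k < 1) {δ r : ℝ} (hδ : 0 ≤ δ) (hr : 1 < r) (k : Fin K) {t : ℕ}
    (ht : 1 ≤ t) :
    μ.real (badEvent κ θ A X Y δ k t) ≤
      2 * (Real.log t / (2 * Real.log r) + 1) * Real.exp (-(δ * (1 - (r - 1) ^ 2))) := by
  obtain ⟨t, rfl⟩ := Nat.exists_eq_succ_of_ne_zero (by omega : t ≠ 0)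
  set J := ⌊Real.log (t + 1 : ℕ) / (2 * Real.log r)⌋₊ with hJ
  have hlog : 0 < Real.log r := Real.log_pos hr
  have hJle : (J : ℝ) ≤ Real.log (t + 1 : ℕ) / (2 * Real.log r) :=
    Nat.floor_le (div_nonneg (Real.log_natCast_nonneg _) (by positivity))
  refine (measureReal_mono (badEvent_subset κ θ A X Y hδ hr k (t + 1))
    (measure_ne_top _ _)).trans ?_
  refine (measureReal_biUnion_finset_le _ _).trans ?_
  calc _ ≤ ∑ j ∈ Finset.range (J + 1), 2 * Real.exp (-(δ * (1 - (r - 1) ^ 2))) := by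
        refine Finset.sum_le_sum fun j _ => (measureReal_union_le _ _).trans ?_
        rw [two_mul]
        exact add_le_add (h.measureReal_expDev_ge_le hκ hθ k _ t _)
          (h.measureReal_expDev_ge_le hκ hθ k _ t _)
    _ = 2 * ((J : ℝ) + 1) * Real.exp (-(δ * (1 - (r - 1) ^ 2))) := by
        rw [Finset.sum_const, Finset.card_range, nsmul_eq_mul]
        push_cast
        ring
    _ ≤ _ := by
        gcongr

end Probability

/-- The failure probabilities of one arm, with `δ = (1 + ε) log t`, are summable over the rounds:
the blocks are chosen fine enough for the loss in the exponent to stay below `ε / 2`. -/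
lemma exists_sum_badEvent_bound {ε : ℝ} (hε : 0 < ε) :
    ∃ r c : ℝ, 1 < r ∧ 0 ≤ c ∧ ∀ T : ℕ, ∑ t ∈ Finset.Icc 1 T,
      2 * (Real.log t / (2 * Real.log r) + 1) *
        Real.exp (-((1 + ε) * Real.log t * (1 - (r - 1) ^ 2))) ≤ c := by
  set ρ := √(ε / (2 * (1 + ε))) with hρ
  have hρ0 : 0 < ρ := Real.sqrt_pos.2 (by positivity)
  have hρ2 : (1 + ε) * (1 - ρ ^ 2) = 1 + ε / 2 := by
    rw [hρ, Real.sq_sqrt (by positivity)]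
    field_simp
    ring
  have hlog : 0 < Real.log (1 + ρ) := Real.log_pos (by linarith)
  set B := 2 * ((1 / (ε / 4)) / (2 * Real.log (1 + ρ)) + 1) with hB
  have hB0 : 0 ≤ B := by positivity
  have hsum : Summable fun t : ℕ => B * (1 / (t : ℝ) ^ (1 + ε / 4)) :=
    (Real.summable_one_div_nat_rpow.2 (by linarith)).mul_left B
  refine ⟨1 + ρ, ∑' t : ℕ, B * (1 / (t : ℝ) ^ (1 + ε / 4)), by linarith,
    tsum_nonneg fun t => by positivity, fun T => ?_⟩
  refine le_trans (Finset.sum_le_sum fun t ht => ?_)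
    (hsum.sum_le_tsum (Finset.Icc 1 T) fun t _ => by positivity)
  have ht1 : (1 : ℝ) ≤ t := by exact_mod_cast (Finset.mem_Icc.1 ht).1
  have ht0 : (0 : ℝ) < t := by linarith
  have e1 : Real.exp (-((1 + ε) * Real.log t * (1 - (1 + ρ - 1) ^ 2)))
      = 1 / (t : ℝ) ^ (1 + ε / 2) := by
    rw [add_sub_cancel_left, show (1 + ε) * Real.log t * (1 - ρ ^ 2)
      = Real.log t * (1 + ε / 2) by rw [← hρ2]; ring, Real.exp_neg,
      ← Real.rpow_def_of_pos ht0, one_div]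
  have e2 : (t : ℝ) ^ (1 + ε / 2) = (t : ℝ) ^ (ε / 4) * (t : ℝ) ^ (1 + ε / 4) := by
    rw [← Real.rpow_add ht0]
    ring_nf
  have h1 : Real.log t ≤ (t : ℝ) ^ (ε / 4) * (1 / (ε / 4)) := by
    have := Real.log_le_rpow_div ht0.le (by positivity : 0 < ε / 4)
    rwa [div_eq_mul_one_div] at this
  have h2 : 1 ≤ (t : ℝ) ^ (ε / 4) := Real.one_le_rpow ht1 (by positivity)
  have h3 : 2 * (Real.log t / (2 * Real.log (1 + ρ)) + 1) ≤ (t : ℝ) ^ (ε / 4) * B := by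
    calc _ ≤ 2 * ((t : ℝ) ^ (ε / 4) * (1 / (ε / 4)) / (2 * Real.log (1 + ρ))
          + (t : ℝ) ^ (ε / 4)) := by gcongr
      _ = _ := by rw [hB]; ring
  rw [e1, e2]
  calc _ ≤ (t : ℝ) ^ (ε / 4) * B * (1 / ((t : ℝ) ^ (ε / 4) * (t : ℝ) ^ (1 + ε / 4))) := by gcongr
    _ = B * (1 / (t : ℝ) ^ (1 + ε / 4)) := by
      have : (t : ℝ) ^ (ε / 4) ≠ 0 := by positivity
      field_simp

/-! ### Indices and regret on the good event -/

section GoodEvent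

variable {Ω : Type*} {K L : ℕ}

lemma countPos_nonneg (A : ℕ → Ω → Action K L) (k : Fin K) (l : Fin L) (t : ℕ) (ω : Ω) :
    0 ≤ countPos A k l t ω :=
  Finset.sum_nonneg fun s _ => by split_ifs <;> simp

lemma mul_count_le_wcount (hL : 0 < L) {κ : Fin L → ℝ} (hκ : Antitone κ)
    (A : ℕ → Ω → Action K L) (k : Fin K) (t : ℕ) (ω : Ω) :
    κ (lastPos hL) * count A k t ω ≤ wcount κ A k t ω := by
  unfold count wcount
  rw [Finset.mul_sum]
  refine Finset.sum_le_sum fun l _ => mul_le_mul_of_nonneg_right (hκ ?_) (countPos_nonneg ..)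
  refine Fin.le_def.2 ?_
  have := l.2
  simp only [lastPos]
  omega

/-- Off the bad event, the index of an arm shown `n ≥ 1` times overestimates its expectation, by at
most `√(D / n)` with `D = 2 δ' / κ_L²` for any `δ' ≥ δ`. -/
lemma ucb_mem_of_notMem_badEvent (hL : 0 < L) {κ : Fin L → ℝ} (hκ : Antitone κ)
    (hpos : ∀ l, 0 < κ l) (θ : Fin K → ℝ) (A : ℕ → Ω → Action K L) (X Y : ℕ → Ω → Fin L → Bool)
    {δ δ' : ℝ} (hδ : 0 ≤ δ) (hδ' : δ ≤ δ') {k : Fin K} {t : ℕ} {ω : Ω}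
    (hn : 1 ≤ shown A k t ω) (hbad : ω ∉ badEvent κ θ A X Y δ k t) :
    (θ k : EReal) ≤ ucb κ A X Y δ k t ω ∧ ucb κ A X Y δ k t ω ≤
      ((θ k + √(2 * δ' / κ (lastPos hL) ^ 2 / shown A k t ω) : ℝ) : EReal) := by
  have hdev : |deviation κ θ A X Y k t ω| ≤ √(shown A k t ω * δ / 2) :=
    not_lt.1 fun h => hbad ⟨hn, h⟩
  have hW' := mul_count_le_wcount hL hκ A k t ω
  unfold deviation at hdev
  unfold ucb
  rw [count_eq_shown] at *
  set n : ℝ := (shown A k t ω : ℝ) with hndef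
  set W := wcount κ A k t ω
  set S := clicks A X Y k t ω
  set q := κ (lastPos hL) with hq
  have hq0 : 0 < q := hpos _
  have hn0 : 0 < n := by
    rw [hndef]
    exact_mod_cast hn
  have hW : 0 < W := (mul_pos hq0 hn0).trans_le hW'
  have hrad : √(n / W) * √(δ / (2 * W)) = √(n * δ / 2) / W := by
    rw [← Real.sqrt_mul (by positivity), show n / W * (δ / (2 * W)) = n * δ / 2 / W ^ 2 by
      field_simp, Real.sqrt_div (by positivity), Real.sqrt_sq hW.le]
  obtain ⟨h1, h2⟩ := abs_le.1 hdev
  rw [if_neg hn0.ne', hrad, ← add_div]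
  constructor
  · refine EReal.coe_le_coe_iff.2 ((le_div_iff₀ hW).2 ?_)
    linarith
  · refine EReal.coe_le_coe_iff.2 ?_
    have h3 : (S + √(n * δ / 2)) / W ≤ θ k + 2 * √(n * δ / 2) / W := by
      rw [div_le_iff₀ hW, add_mul, div_mul_cancel₀ _ hW.ne']
      linarith
    have h4 : 2 * √(n * δ / 2) / W ≤ 2 * √(n * δ / 2) / (q * n) := by
      gcongr
    have h5 : 2 * √(n * δ / 2) / (q * n) ≤ √(2 * δ' / q ^ 2 / n) := by
      refine Real.le_sqrt_of_sq_le ?_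
      have e : (2 * √(n * δ / 2) / (q * n)) ^ 2 = 2 * δ / q ^ 2 / n := by
        rw [div_pow, mul_pow, Real.sq_sqrt (by positivity)]
        field_simp
      rw [e]
      gcongr
    linarith

lemma gap_le {κ : Fin L → ℝ} {θ : Fin K → ℝ} (hLK : L ≤ K) (hκ : ∀ l, 0 < κ l ∧ κ l ≤ 1)
    (hθ : ∀ k, 0 < θ k ∧ θ k < 1) (a : Action K L) : gap hLK κ θ a ≤ L := by
  have h1 : meanReward κ θ (optimalAction hLK) ≤ L := by
    calc meanReward κ θ (optimalAction hLK) ≤ ∑ _l : Fin L, (1 : ℝ) :=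
          Finset.sum_le_sum fun l _ => mul_le_one₀ (hκ l).2 (hθ _).1.le (hθ _).2.le
      _ = L := by simp
  have h2 : 0 ≤ meanReward κ θ a :=
    Finset.sum_nonneg fun l _ => mul_nonneg (hκ l).1.le (hθ _).1.le
  unfold gap
  linarith

open Classical in
/-- Regret of one round: a failing confidence bound or the first display of an arm costs at most
`L`; otherwise `gap_le_of_isTopList` applies. -/
lemma gap_action_le (hL : 0 < L) (hLK : L ≤ K) {κ : Fin L → ℝ} {θ : Fin K → ℝ}
    (hκ : StrictAnti κ) (hκ1 : ∀ l, 0 < κ l ∧ κ l ≤ 1) (hθ : StrictAnti θ)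
    (hθ1 : ∀ k, 0 < θ k ∧ θ k < 1) {A : ℕ → Ω → Action K L} {X Y : ℕ → Ω → Fin L → Bool}
    {δ δ' : ℝ} (hδ : 0 ≤ δ) (hδ' : δ ≤ δ') {t : ℕ} {ω : Ω}
    (htop : IsTopList (fun k => ucb κ A X Y δ k t ω) (A t ω)) :
    gap hLK κ θ (A t ω) ≤
      ∑ k, (L * Set.indicator (badEvent κ θ A X Y δ k t) (fun _ => (1 : ℝ)) ω +
        if ∃ l, A t ω l = k then (if shown A k t ω = 0 then (L : ℝ) else 0) else 0) +
      ∑ m, kappaStep κ m * ∑ k ∈ Finset.univ.filter (optimalAction hLK m < ·),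
        if ∃ l, A t ω l = k then
          (if 1 ≤ shown A k t ω ∧ θ (optimalAction hLK m) - θ k ≤
              √(2 * δ' / κ (lastPos hL) ^ 2 / shown A k t ω)
            then √(2 * δ' / κ (lastPos hL) ^ 2 / shown A k t ω) else 0) else 0 := by
  have hposκ : ∀ l, 0 < κ l := fun l => (hκ1 l).1
  have hfirst : ∀ k, 0 ≤ L * Set.indicator (badEvent κ θ A X Y δ k t) (fun _ => (1 : ℝ)) ω +
        if ∃ l, A t ω l = k then (if shown A k t ω = 0 then (L : ℝ) else 0) else 0 := by
    intro k
    refine add_nonneg (mul_nonneg (by positivity)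
      (Set.indicator_nonneg (fun _ _ => zero_le_one) _)) ?_
    split_ifs <;> positivity
  have hsecond : 0 ≤ ∑ m, kappaStep κ m * ∑ k ∈ Finset.univ.filter (optimalAction hLK m < ·),
        if ∃ l, A t ω l = k then
          (if 1 ≤ shown A k t ω ∧ θ (optimalAction hLK m) - θ k ≤
              √(2 * δ' / κ (lastPos hL) ^ 2 / shown A k t ω)
            then √(2 * δ' / κ (lastPos hL) ^ 2 / shown A k t ω) else 0) else 0 := by
    refine Finset.sum_nonneg fun m _ => mul_nonneg (kappaStep_nonneg hκ hposκ m)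
      (Finset.sum_nonneg fun k _ => ?_)
    split_ifs <;> positivity
  by_cases hbad : ∃ k, ω ∈ badEvent κ θ A X Y δ k t ∨
      ((∃ l, A t ω l = k) ∧ shown A k t ω = 0)
  · obtain ⟨k, hk⟩ := hbad
    have h1 : (L : ℝ) ≤ L * Set.indicator (badEvent κ θ A X Y δ k t) (fun _ => (1 : ℝ)) ω +
        if ∃ l, A t ω l = k then (if shown A k t ω = 0 then (L : ℝ) else 0) else 0 := by
      rcases hk with hk | ⟨hk1, hk2⟩
      · rw [Set.indicator_of_mem hk, mul_one, le_add_iff_nonneg_right]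
        split_ifs <;> positivity
      · rw [if_pos hk1, if_pos hk2, le_add_iff_nonneg_left]
        exact mul_nonneg (by positivity) (Set.indicator_nonneg (fun _ _ => zero_le_one) _)
    have h2 := Finset.single_le_sum (fun k _ => hfirst k) (Finset.mem_univ k)
    have h3 := gap_le hLK hκ1 hθ1 (A t ω)
    linarith
  · push Not at hbad
    have hshown : ∀ l, 1 ≤ shown A (A t ω l) t ω := fun l =>
      Nat.one_le_iff_ne_zero.2 ((hbad _).2 ⟨l, rfl⟩)
    have hmain := gap_le_of_isTopList hLK hκ hposκ hθ htop
      (b := fun k => √(2 * δ' / κ (lastPos hL) ^ 2 / shown A k t ω))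
      (fun k => Real.sqrt_nonneg _) (fun k => ?_) fun l => ?_
    · refine hmain.trans (le_trans (le_of_eq ?_)
        (le_add_of_nonneg_left (Finset.sum_nonneg fun k _ => hfirst k)))
      refine Finset.sum_congr rfl fun m _ => congrArg _ (Finset.sum_congr rfl fun k _ => ?_)
      by_cases hk : ∃ l, A t ω l = k
      · have h1 : 1 ≤ shown A k t ω := by
          obtain ⟨l, rfl⟩ := hk
          exact hshown l
        simp [hk, h1]
      · simp [hk]
    · by_cases h0 : shown A k t ω = 0
      · simp [ucb, count_eq_shown, h0]
      · exact (ucb_mem_of_notMem_badEvent hL hκ.antitone hposκ θ A X Y hδ hδ'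
          (Nat.one_le_iff_ne_zero.2 h0) (hbad k).1).1
    · exact (ucb_mem_of_notMem_badEvent hL hκ.antitone hposκ θ A X Y hδ hδ'
        (hshown l) (hbad _).1).2

/-- Pathwise regret bound over `T` rounds. -/
lemma sum_gap_le (hL : 0 < L) (hLK : L ≤ K) {κ : Fin L → ℝ} {θ : Fin K → ℝ}
    (hκ : StrictAnti κ) (hκ1 : ∀ l, 0 < κ l ∧ κ l ≤ 1) (hθ : StrictAnti θ)
    (hθ1 : ∀ k, 0 < θ k ∧ θ k < 1) {A : ℕ → Ω → Action K L} {X Y : ℕ → Ω → Fin L → Bool}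
    {ε : ℝ} (hε : 0 < ε) (halg : FollowsPBMUCB ε κ A X Y) (T : ℕ) (ω : Ω) :
    ∑ t ∈ Finset.Icc 1 T, gap hLK κ θ (A t ω) ≤
      L * ∑ k, ∑ t ∈ Finset.Icc 1 T,
        Set.indicator (badEvent κ θ A X Y ((1 + ε) * Real.log t) k t) (fun _ => (1 : ℝ)) ω +
      L * K +
      2 * (2 * ((1 + ε) * Real.log T) / κ (lastPos hL) ^ 2) *
        (κ ⟨0, hL⟩ ^ 2 * (permTerm hLK κ θ +
          ∑ k ∈ Finset.univ.filter (fun k : Fin K => k ∉ Set.range (optimalAction hLK)),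
            1 / (κ (lastPos hL) * (θ (optimalAction hLK (lastPos hL)) - θ k)))) := by
  classical
  have hposκ : ∀ l, 0 < κ l := fun l => (hκ1 l).1
  set D := 2 * ((1 + ε) * Real.log T) / κ (lastPos hL) ^ 2 with hD
  have hD0 : 0 ≤ D := by
    have := Real.log_natCast_nonneg T
    positivity
  have hround : ∀ t ∈ Finset.Icc 1 T, _ := fun t ht =>
    gap_action_le (δ := (1 + ε) * Real.log t) (δ' := (1 + ε) * Real.log T) hL hLK hκ hκ1 hθ hθ1
      (mul_nonneg (by linarith) (Real.log_natCast_nonneg t))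
      (mul_le_mul_of_nonneg_left (Real.log_le_log
        (by exact_mod_cast (Finset.mem_Icc.1 ht).1) (by exact_mod_cast (Finset.mem_Icc.1 ht).2))
        (by linarith))
      (halg t (Finset.mem_Icc.1 ht).1 ω)
  refine (Finset.sum_le_sum hround).trans ?_
  rw [Finset.sum_add_distrib]
  refine add_le_add ?_ ?_
  · rw [Finset.sum_comm]
    simp only [Finset.sum_add_distrib, ← Finset.mul_sum]
    refine add_le_add le_rfl ?_
    calc _ ≤ ∑ _k : Fin K, (L : ℝ) := by
          refine Finset.sum_le_sum fun k _ => ?_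
          rw [sum_shown A k (fun n => if n = 0 then (L : ℝ) else 0)]
          rw [Finset.sum_ite_eq']
          split_ifs <;> simp
      _ = L * K := by simp [mul_comm]
  · rw [Finset.sum_comm]
    refine le_trans ?_ (mul_le_mul_of_nonneg_left
      (sum_kappaStep_div_le hL hLK hκ hposκ hθ) (by positivity))
    rw [Finset.mul_sum]
    refine Finset.sum_le_sum fun m _ => ?_
    rw [← Finset.mul_sum, Finset.sum_comm, mul_left_comm (2 * D)]
    refine mul_le_mul_of_nonneg_left ?_ (kappaStep_nonneg hκ hposκ m)
    rw [Finset.mul_sum]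
    refine Finset.sum_le_sum fun k hk => ?_
    have hg : 0 < θ (optimalAction hLK m) - θ k := sub_pos.2 (hθ (by simpa using hk))
    rw [sum_shown A k (fun n => if 1 ≤ n ∧ θ (optimalAction hLK m) - θ k ≤ √(D / n)
      then √(D / n) else 0), mul_one_div]
    exact sum_sqrt_div_le hD0 hg _

end GoodEvent

/-! ### Expected regret -/

section ExpectedRegret

variable {Ω : Type*} {K L : ℕ} [mΩ : MeasurableSpace Ω] {μ : Measure Ω}
  {ℱ : Filtration ℕ mΩ} {κ : Fin L → ℝ} {θ : Fin K → ℝ} {A : ℕ → Ω → Action K L}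
  {X Y : ℕ → Ω → Fin L → Bool}

lemma IsRun.measurable_count_deviation (h : IsRun μ ℱ κ θ A X Y) (k : Fin K) (t : ℕ) :
    Measurable (count A k (t + 1)) ∧ Measurable (deviation κ θ A X Y k (t + 1)) := by
  induction t with
  | zero =>
    have h1 : count A k 1 = fun _ => 0 := by
      ext ω
      simp [count, countPos]
    have h2 : deviation κ θ A X Y k 1 = fun _ => 0 := by
      ext ω
      simp [deviation, clicks, wcount, countPos]
    rw [zero_add, h1, h2]
    exact ⟨measurable_const, measurable_const⟩
  | succ t ih =>
    have hI : ∀ l, Measurable fun ω => if A (t + 1) ω l = k then (1 : ℝ) else 0 := fun l =>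
      (h.measurable_comp_action t fun a => if a l = k then 1 else 0).mono (ℱ.le t) le_rfl
    constructor
    · rw [show count A k (t + 1 + 1) = _ from
        funext fun ω => count_succ A k (t := t + 1) (by omega) ω]
      exact ih.1.add (Finset.measurable_fun_sum _ fun l _ => hI l)
    · rw [show deviation κ θ A X Y k (t + 1 + 1) = _ from
        funext fun ω => deviation_succ κ θ A X Y k (t := t + 1) (by omega) ω]
      refine ih.2.add (Finset.measurable_fun_sum _ fun l _ => ?_)
      exact (((h.obs_adapted t l).mono (ℱ.le _) le_rfl).sub_const _).mul (hI l)

lemma IsRun.measurableSet_badEvent (h : IsRun μ ℱ κ θ A X Y) (δ : ℝ) (k : Fin K) {t : ℕ}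
    (ht : 1 ≤ t) : MeasurableSet (badEvent κ θ A X Y δ k t) := by
  obtain ⟨t, rfl⟩ := Nat.exists_eq_succ_of_ne_zero (by omega : t ≠ 0)
  obtain ⟨h1, h2⟩ := h.measurable_count_deviation k t
  have : badEvent κ θ A X Y δ k (t + 1) = {ω | 1 ≤ count A k (t + 1) ω} ∩
      {ω | √(count A k (t + 1) ω * δ / 2) < |deviation κ θ A X Y k (t + 1) ω|} := by
    ext ω
    simp [badEvent, count_eq_shown]
  rw [Nat.succ_eq_add_one, this]
  exact (measurableSet_le measurable_const h1).inter
    (measurableSet_lt ((h1.mul_const δ).div_const 2).sqrt h2.abs)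

variable [IsProbabilityMeasure μ]

lemma IsRun.integrable_gap (h : IsRun μ ℱ κ θ A X Y) (hLK : L ≤ K) {t : ℕ} (ht : 1 ≤ t) :
    Integrable (fun ω => gap hLK κ θ (A t ω)) μ := by
  obtain ⟨t, rfl⟩ := Nat.exists_eq_succ_of_ne_zero (by omega : t ≠ 0)
  refine Integrable.of_bound ((h.measurable_comp_action t (gap hLK κ θ)).mono
    (ℱ.le t) le_rfl).aestronglyMeasurable (∑ a, |gap hLK κ θ a|) ?_
  exact Filter.Eventually.of_forall fun ω => Finset.single_le_sum
    (f := fun a => |gap hLK κ θ a|) (fun a _ => abs_nonneg _) (Finset.mem_univ _)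

lemma IsRun.expectedRegret_eq (h : IsRun μ ℱ κ θ A X Y) (hLK : L ≤ K) (T : ℕ) :
    expectedRegret μ hLK κ θ X Y T = ∫ ω, ∑ t ∈ Finset.Icc 1 T, gap hLK κ θ (A t ω) ∂μ := by
  unfold expectedRegret
  have hobs : ∀ t ∈ Finset.Icc 1 T, ∀ l, Integrable (obs X Y t l) μ := by
    intro t ht l
    obtain ⟨t, rfl⟩ := Nat.exists_eq_succ_of_ne_zero (by
      have := (Finset.mem_Icc.1 ht).1
      omega : t ≠ 0)
    exact h.integrable_obs t l
  have hreward : ∀ t ∈ Finset.Icc 1 T, Integrable (fun ω =>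
      meanReward κ θ (optimalAction hLK) - ∑ l, obs X Y t l ω) μ := fun t ht =>
    (integrable_const _).sub (integrable_finsetSum _ fun l _ => hobs t ht l)
  rw [integral_finsetSum _ hreward,
    integral_finsetSum _ fun t ht => h.integrable_gap hLK (Finset.mem_Icc.1 ht).1]
  refine Finset.sum_congr rfl fun t ht => ?_
  have hobs' := hobs t ht
  obtain ⟨t, rfl⟩ := Nat.exists_eq_succ_of_ne_zero (by
    have := (Finset.mem_Icc.1 ht).1
    omega : t ≠ 0)
  have hmean : ∀ l, Integrable (fun ω => κ l * θ (A (t + 1) ω l)) μ := fun l =>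
    Integrable.of_bound ((h.measurable_comp_action t fun a => κ l * θ (a l)).mono
      (ℱ.le t) le_rfl).aestronglyMeasurable (∑ k, |κ l * θ k|)
      (Filter.Eventually.of_forall fun ω => Finset.single_le_sum
        (f := fun k => |κ l * θ k|) (fun a _ => abs_nonneg _) (Finset.mem_univ _))
  simp only [gap, meanReward, Nat.succ_eq_add_one] at *
  rw [integral_sub (integrable_const _) (integrable_finsetSum _ fun l _ => hobs' l),
    integral_sub (integrable_const _) (integrable_finsetSum _ fun l _ => hmean l),
    integral_finsetSum _ fun l _ => hobs' l, integral_finsetSum _ fun l _ => hmean l]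
  congr 1
  refine Finset.sum_congr rfl fun l _ => ?_
  simpa using h.integral_mul_obs t l (W := fun _ => 1) measurable_const (C := 1) (by simp)

lemma IsRun.expectedRegret_le_mul (h : IsRun μ ℱ κ θ A X Y) (hLK : L ≤ K)
    (hκ1 : ∀ l, 0 < κ l ∧ κ l ≤ 1) (hθ1 : ∀ k, 0 < θ k ∧ θ k < 1) (T : ℕ) :
    expectedRegret μ hLK κ θ X Y T ≤ L * T := by
  rw [h.expectedRegret_eq hLK T]
  calc _ ≤ ∫ _ω, (L * T : ℝ) ∂μ := by
        refine integral_mono (integrable_finsetSum _ fun t ht =>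
          h.integrable_gap hLK (Finset.mem_Icc.1 ht).1) (integrable_const _) fun ω => ?_
        refine (Finset.sum_le_card_nsmul _ _ (L : ℝ) fun t _ =>
          gap_le hLK hκ1 hθ1 (A t ω)).trans ?_
        simp [mul_comm]
    _ = L * T := by simp

/-- Regret bound with an additive term that is linear in the number of arms. -/
lemma IsRun.expectedRegret_le (h : IsRun μ ℱ κ θ A X Y) (hL : 0 < L) (hLK : L ≤ K)
    (hκ : StrictAnti κ) (hκ1 : ∀ l, 0 < κ l ∧ κ l ≤ 1) (hθ : StrictAnti θ)
    (hθ1 : ∀ k, 0 < θ k ∧ θ k < 1) {ε : ℝ} (hε : 0 < ε) (halg : FollowsPBMUCB ε κ A X Y)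
    {r c : ℝ} (hr : 1 < r) (hc : ∀ T : ℕ, ∑ t ∈ Finset.Icc 1 T,
      2 * (Real.log t / (2 * Real.log r) + 1) *
        Real.exp (-((1 + ε) * Real.log t * (1 - (r - 1) ^ 2))) ≤ c) (T : ℕ) :
    expectedRegret μ hLK κ θ X Y T ≤ L * (c + 1) * K +
      2 * (2 * ((1 + ε) * Real.log T) / κ (lastPos hL) ^ 2) *
        (κ ⟨0, hL⟩ ^ 2 * (permTerm hLK κ θ +
          ∑ k ∈ Finset.univ.filter (fun k : Fin K => k ∉ Set.range (optimalAction hLK)),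
            1 / (κ (lastPos hL) * (θ (optimalAction hLK (lastPos hL)) - θ k)))) := by
  rw [h.expectedRegret_eq hLK T]
  set G := 2 * (2 * ((1 + ε) * Real.log T) / κ (lastPos hL) ^ 2) *
        (κ ⟨0, hL⟩ ^ 2 * (permTerm hLK κ θ +
          ∑ k ∈ Finset.univ.filter (fun k : Fin K => k ∉ Set.range (optimalAction hLK)),
            1 / (κ (lastPos hL) * (θ (optimalAction hLK (lastPos hL)) - θ k)))) with hG
  have hms : ∀ k, ∀ t ∈ Finset.Icc 1 T,
      MeasurableSet (badEvent κ θ A X Y ((1 + ε) * Real.log t) k t) := fun k t ht =>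
    h.measurableSet_badEvent _ k (Finset.mem_Icc.1 ht).1
  have hind : ∀ k, ∀ t ∈ Finset.Icc 1 T, Integrable (Set.indicator
      (badEvent κ θ A X Y ((1 + ε) * Real.log t) k t) (fun _ => (1 : ℝ))) μ := fun k t ht =>
    (integrable_const 1).indicator (hms k t ht)
  have hsumint : Integrable (fun ω => ∑ k, ∑ t ∈ Finset.Icc 1 T, Set.indicator
      (badEvent κ θ A X Y ((1 + ε) * Real.log t) k t) (fun _ => (1 : ℝ)) ω) μ :=
    integrable_finsetSum _ fun k _ => integrable_finsetSum _ fun t ht => hind k t ht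
  have hLint := hsumint.const_mul (L : ℝ)
  have hLKint : Integrable (fun ω => L * ∑ k, ∑ t ∈ Finset.Icc 1 T, Set.indicator
      (badEvent κ θ A X Y ((1 + ε) * Real.log t) k t) (fun _ => (1 : ℝ)) ω + (L : ℝ) * K) μ :=
    hLint.add (integrable_const _)
  calc _ ≤ ∫ ω, (L * ∑ k, ∑ t ∈ Finset.Icc 1 T, Set.indicator
        (badEvent κ θ A X Y ((1 + ε) * Real.log t) k t) (fun _ => (1 : ℝ)) ω + L * K + G) ∂μ :=
        integral_mono (integrable_finsetSum _ fun t ht =>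
          h.integrable_gap hLK (Finset.mem_Icc.1 ht).1)
          (hLKint.add (integrable_const _))
          fun ω => sum_gap_le hL hLK hκ hκ1 hθ hθ1 hε halg T ω
    _ = L * ∑ k, ∑ t ∈ Finset.Icc 1 T,
          μ.real (badEvent κ θ A X Y ((1 + ε) * Real.log t) k t) + L * K + G := by
        rw [integral_add hLKint (integrable_const _),
          integral_add hLint (integrable_const _), integral_const_mul,
          integral_finsetSum _ fun k _ => integrable_finsetSum _ fun t ht => hind k t ht]
        simp only [integral_const, probReal_univ, one_smul]
        congr 3
        refine Finset.sum_congr rfl fun k _ => ?_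
        rw [integral_finsetSum _ fun t ht => hind k t ht]
        refine Finset.sum_congr rfl fun t ht => ?_
        rw [integral_indicator_const _ (hms k t ht)]
        simp
    _ ≤ L * ∑ _k : Fin K, c + L * K + G := by
        gcongr with k
        refine (Finset.sum_le_sum fun t ht => ?_).trans (hc T)
        exact h.measureReal_badEvent_le hκ1 hθ1
          (mul_nonneg (by linarith) (Real.log_natCast_nonneg t)) hr k (Finset.mem_Icc.1 ht).1
    _ = L * (c + 1) * K + G := by
        simp
        ring

end ExpectedRegret

/-- There are `K - L` suboptimal arms, each with a term at least `1` in the regret bound. -/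
lemma le_sum_suboptimal {K L : ℕ} (hL : 0 < L) (hLK : L ≤ K) {κ : Fin L → ℝ} {θ : Fin K → ℝ}
    (hκ1 : ∀ l, 0 < κ l ∧ κ l ≤ 1) (hθ : StrictAnti θ) (hθ1 : ∀ k, 0 < θ k ∧ θ k < 1) :
    (K : ℝ) - L ≤ ∑ k ∈ Finset.univ.filter (fun k : Fin K => k ∉ Set.range (optimalAction hLK)),
      1 / (κ (lastPos hL) * (θ (optimalAction hLK (lastPos hL)) - θ k)) := by
  classical
  have hcard : ((Finset.univ.filter
      (fun k : Fin K => k ∉ Set.range (optimalAction hLK))).card : ℝ) = K - L := by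
    have : Finset.univ.filter (fun k : Fin K => k ∉ Set.range (optimalAction hLK))
        = (Finset.univ.map (optimalAction hLK))ᶜ := by
      ext k
      simp
    rw [this, Finset.card_compl]
    simp [Nat.cast_sub hLK]
  rw [← hcard, ← nsmul_one]
  refine Finset.card_nsmul_le_sum _ _ _ fun k hk => ?_
  have hlt : optimalAction hLK (lastPos hL) < k := by
    refine Fin.lt_def.2 ?_
    by_contra hc
    refine (Finset.mem_filter.1 hk).2 ⟨⟨k, ?_⟩, rfl⟩
    have h' : (k : ℕ) ≤ L - 1 := not_lt.1 hc
    omega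
  have hpos : 0 < θ (optimalAction hLK (lastPos hL)) - θ k := sub_pos.2 (hθ hlt)
  rw [le_div_iff₀ (mul_pos (hκ1 _).1 hpos), one_mul]
  exact mul_le_one₀ (hκ1 _).2 hpos.le
    (by linarith [(hθ1 k).1, (hθ1 (optimalAction hLK (lastPos hL))).2])

end PBM

theorem theorem4 (ε : ℝ) (hε : 0 < ε) (L : ℕ) (hL : 0 < L) :
    ∃ C₀ : ℝ, ∀ (K : ℕ) (hLK : L ≤ K) (κ : Fin L → ℝ) (θ : Fin K → ℝ),
      StrictAnti κ → (∀ l, 0 < κ l ∧ κ l ≤ 1) →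
      StrictAnti θ → (∀ k, 0 < θ k ∧ θ k < 1) →
      ∀ (Ω : Type*) [mΩ : MeasurableSpace Ω] (μ : Measure Ω) [IsProbabilityMeasure μ]
        (ℱ : Filtration ℕ mΩ) (A : ℕ → Ω → PBM.Action K L) (X Y : ℕ → Ω → Fin L → Bool),
        PBM.IsRun μ ℱ κ θ A X Y → PBM.FollowsPBMUCB ε κ A X Y →
        ∀ T : ℕ, 1 ≤ T →
          PBM.expectedRegret μ hLK κ θ X Y T ≤
            C₀ + 16 * (1 + ε) * PBM.kappaConst hL κ * Real.log T *
              (PBM.permTerm hLK κ θ +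
                ∑ k ∈ Finset.univ.filter (fun k : Fin K => k ∉ Set.range (PBM.optimalAction hLK)),
                  1 / (κ (PBM.lastPos hL) *
                    (θ (PBM.optimalAction hLK (PBM.lastPos hL)) - θ k))) := by
  obtain ⟨r, c, hr, hc0, hc⟩ := PBM.exists_sum_badEvent_bound hε
  set M := (L : ℝ) * (c + 1) with hM
  have hM0 : 0 ≤ M := by positivity
  refine ⟨L * Real.exp M + M * L, ?_⟩
  intro K hLK κ θ hκ hκ1 hθ hθ1 Ω _ μ _ ℱ A X Y hrun halg T hT
  have hposκ : ∀ l, 0 < κ l := fun l => (hκ1 l).1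
  have hC := PBM.kappa_sq_div_le_kappaConst hL hposκ
  have hH := PBM.le_sum_suboptimal hL hLK hκ1 hθ hθ1
  have hbound := hrun.expectedRegret_le hL hLK hκ hκ1 hθ hθ1 hε halg hr hc T
  set H := ∑ k ∈ Finset.univ.filter (fun k : Fin K => k ∉ Set.range (PBM.optimalAction hLK)),
    1 / (κ (PBM.lastPos hL) * (θ (PBM.optimalAction hLK (PBM.lastPos hL)) - θ k))
  have hP : 0 ≤ PBM.permTerm hLK κ θ := by
    unfold PBM.permTerm
    split_ifs
    · exact div_nonneg (by positivity) (PBM.minPermGap_nonneg hLK hκ hθ)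
    · exact le_rfl
  set P := PBM.permTerm hLK κ θ
  set q := κ ⟨0, hL⟩ ^ 2 / κ (PBM.lastPos hL) ^ 2 with hq
  have hKL : (0 : ℝ) ≤ K - L := sub_nonneg.2 (by exact_mod_cast hLK)
  have hq1 : 1 ≤ q := by
    rw [hq, one_le_div₀ (pow_pos (hposκ _) 2)]
    exact pow_le_pow_left₀ (hposκ _).le (hκ.antitone (Fin.le_def.2 (Nat.zero_le _))) 2
  have hlogT : 0 ≤ Real.log T := Real.log_natCast_nonneg T
  have hbudget : 16 * (1 + ε) * q * Real.log T * (P + H)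
      ≤ 16 * (1 + ε) * PBM.kappaConst hL κ * Real.log T * (P + H) := by
    have : 0 ≤ P + H := by linarith
    gcongr
  have hexp := Real.exp_pos M
  -- for small `T` the trivial bound `L * T` is a constant; for large `T` the part of the
  -- logarithmic term that the main estimate leaves free absorbs the term linear in `K`
  rcases le_or_gt M (Real.log T) with hlarge | hsmall
  · have e : 2 * (2 * ((1 + ε) * Real.log T) / κ (PBM.lastPos hL) ^ 2) *
        (κ ⟨0, hL⟩ ^ 2 * (P + H)) = 4 * (1 + ε) * q * Real.log T * (P + H) := by
      rw [hq]
      ring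
    rw [e] at hbound
    have h1 : M * (K - L) ≤ (1 + ε) * q * Real.log T * (P + H) := by
      have h2 : M ≤ (1 + ε) * q * Real.log T := by
        have : 1 ≤ (1 + ε) * q := one_le_mul_of_one_le_of_one_le (by linarith) hq1
        exact hlarge.trans (le_mul_of_one_le_left hlogT this)
      exact mul_le_mul h2 (by linarith) hKL (hM0.trans h2)
    have h3 : 0 ≤ M * (K - L) := mul_nonneg hM0 hKL
    have h4 : 0 ≤ (L : ℝ) * Real.exp M := by positivity
    linarith
  · have hT' : (T : ℝ) ≤ Real.exp M := by
      rw [← Real.exp_log (show (0 : ℝ) < T by exact_mod_cast hT)]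
      exact Real.exp_le_exp.2 hsmall.le
    have h1 := hrun.expectedRegret_le_mul hLK hκ1 hθ1 T
    have h2 : (L : ℝ) * T ≤ L * Real.exp M := by gcongr
    have h3 : 0 ≤ 16 * (1 + ε) * q * Real.log T * (P + H) := by
      have : 0 ≤ P + H := by linarith
      positivity
    have h4 : 0 ≤ M * L := by positivity
    linarith
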